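/- All rings are commutative with $1$; the zero ring is allowed. For a ring $R$ let $\mathbb B=\mathbb B(R)$ be the Boolean algebra of idempotents of $R$, with $e\wedge f=ef$, $e\vee f=e+f-ef$, $\neg e=1-e$, so that $e\le f$ means $ef=e$. For an idempotent $e$ let $R_e$ (the stalk of $R$ at $e$) be the localization of $R$ at the powers of $e$, and for a tuple $\bar f$ from $R$ let $\bar f_e$ be its image in $R_e$. A ring is *connected* if $0\neq 1$ and its only idempotents are $0$ and $1$. A *partition* of a Boolean algebra is a finite sequence of pairwise disjoint elements (possibly $0$) with join $1$. The language of rings is $\{+,\cdot,-,0,1\}$, the language of Boolean algebras is $\{\wedge,\vee,\neg,0,1\}$, and $\equiv$ denotes elementary equivalence of rings in the language of rings. A ring $R$ *satisfies AXIOMS* if the following five conditions hold. 1. $\mathbb B$ is atomic. 2. For every ring formula $\theta(\bar x)$ and every tuple $\bar f$ from $R$ there is a unique element $[\![\theta(\bar f)]\!]\in\mathbb B$ such that, for all atoms $e$ of $\mathbb B$, $R_e\models\theta(\bar f_e)$ if and only if $e\le[\![\theta(\bar f)]\!]$. 3. For every ring formula $\theta(\bar x,w)$ and every tuple $\bar f$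 from $R$ there is $g\in R$ with $[\![\exists w\,\theta(\bar f,w)]\!]\le[\![\theta(\bar f,g)]\!]$. 4. For every atomic ring formula $\theta(\bar x)$ and every tuple $\bar f$ from $R$, $R\models\theta(\bar f)$ if and only if $[\![\theta(\bar f)]\!]=1$. 5. Let $\phi(v_0,\dots,v_m)$ be any formula in the language of Boolean algebras, and let $\phi^*(v_0,\dots,v_m)$ say that there is a partition $W_0,\dots,W_m$ with $W_j\le v_j$ for all $j$ and $\phi(W_0,\dots,W_m)$. Let $\theta_0(\bar x,w),\dots,\theta_m(\bar x,w)$ be ring formulas forming a partition sequence, i.e. in every ring $S$ satisfying conditions 1–4, for every tuple $\bar a$ from $S$, the elements $[\![\theta_0(\bar a)]\!],\dots,[\![\theta_m(\bar a)]\!]$ form a partition of $\mathbb B(S)$. Then, for every tuple $\bar f$ from $R$, the following are equivalent: (i) there is $g\in R$ such that $\mathbb B\models\phi^*([\![\theta_0(\bar f,g)]\!],\dots,[\![\theta_m(\bar f,g)]\!])$; (ii) there is a partition $Y_0,\dots,Y_m$ of $\mathbb B$ with $Y_j\le[\![\exists w\,\theta_j(\bar f,w)]\!]$ for all $j$ and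 $\mathbb B\models\phi(Y_0,\dots,Y_m)$. **Theorem.** (a) If $R$ satisfies AXIOMS, then $R\equiv\prod_{e}R_e$, the full product over all atoms $e$ of $\mathbb B$. (b) Every product $\prod_{i\in I}S_i$ of connected rings (with $I$ any set, possibly empty) satisfies AXIOMS. (c) A ring $R$ satisfies AXIOMS if and only if $R$ is elementarily equivalent to a product $\prod_{i\in I}S_i$ of connected rings. -/

import Mathlib

open FirstOrder

universe u

namespace FVRing

/-! ### First-order logic of rings -/

/-- The standard structure, for Mathlib's language of rings, on a commutative ring. -/
abbrev ringStructure (R : Type u) [CommRing R] : Language.ring.Structure R :=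
  (FirstOrder.Ring.compatibleRingOfRing R).toStructure

/-- `R ⊨ θ(f)`. -/
def Sat (R : Type u) [CommRing R] {n : ℕ} (θ : Language.ring.Formula (Fin n)) (f : Fin n → R) :
    Prop :=
  letI := ringStructure R
  θ.Realize f

/-- `R ≡ S` as rings. -/
def ElemEquiv (R S : Type u) [CommRing R] [CommRing S] : Prop :=
  letI := ringStructure R
  letI := ringStructure S
  Language.ring.ElementarilyEquivalent R S

/-- The formula `∃ w, θ(x₀, …, x_{n-1}, w)`, where `w` is the last variable of `θ`. -/
def exLast {n : ℕ} (θ : Language.ring.Formula (Fin (n + 1))) : Language.ring.Formula (Fin n) :=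
  FirstOrder.Language.BoundedFormula.ex
    (FirstOrder.Language.BoundedFormula.relabel (n := 1) (k := 0)
      (Fin.lastCases (motive := fun _ => Fin n ⊕ Fin 1) (Sum.inr 0) Sum.inl) θ)

theorem sat_exLast (R : Type u) [CommRing R] {n : ℕ} (θ : Language.ring.Formula (Fin (n + 1)))
    (f : Fin n → R) : Sat R (exLast θ) f ↔ ∃ g : R, Sat R θ (Fin.snoc f g) := by
  let _ := ringStructure R
  unfold Sat exLast
  refine FirstOrder.Language.BoundedFormula.realize_ex.trans (exists_congr fun g => ?_)
  refine FirstOrder.Language.BoundedFormula.realize_relabel.trans ?_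
  unfold FirstOrder.Language.Formula.Realize
  refine iff_of_eq (congr_arg₂ _ (funext fun i => ?_) (Subsingleton.elim _ _))
  refine Fin.lastCases ?_ (fun i => ?_) i
  · simp [Fin.snoc]
  · simp

/-! ### The language of Boolean algebras -/

/-- The function symbols `∧, ∨, ¬, 0, 1`. -/
inductive BoolFunc : ℕ → Type
  | inf : BoolFunc 2
  | sup : BoolFunc 2
  | compl : BoolFunc 1
  | bot : BoolFunc 0
  | top : BoolFunc 0

/-- The language of Boolean algebras. -/
def boolLang : FirstOrder.Language where
  Functions := BoolFunc
  Relations := fun _ => Empty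

/-- The standard structure, for the language of Boolean algebras, on a Boolean algebra. -/
abbrev boolStructure (B : Type u) [BooleanAlgebra B] : boolLang.Structure B where
  funMap := fun {n} f =>
    match n, f with
    | _, .inf => fun x => x 0 ⊓ x 1
    | _, .sup => fun x => x 0 ⊔ x 1
    | _, .compl => fun x => (x 0)ᶜ
    | _, .bot => fun _ => ⊥
    | _, .top => fun _ => ⊤
  RelMap := fun r => r.elim

/-- `B ⊨ φ(y)`. -/
def BoolSat (B : Type u) [BooleanAlgebra B] {m : ℕ} (φ : boolLang.Formula (Fin m))
    (y : Fin m → B) : Prop :=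
  letI := boolStructure B
  φ.Realize y

/-- A finite sequence of pairwise disjoint elements with join `1`; entries may be `0`. -/
def IsPartition {B : Type u} [BooleanAlgebra B] {m : ℕ} (Y : Fin m → B) : Prop :=
  Finset.univ.sup Y = ⊤ ∧ ∀ i j, i ≠ j → Y i ⊓ Y j = ⊥

/-- `B ⊨ φ*(v)`: some partition `W` of `B` with `Wⱼ ≤ vⱼ` for all `j` satisfies `φ`. -/
def StarSat (B : Type u) [BooleanAlgebra B] {m : ℕ} (φ : boolLang.Formula (Fin m))
    (v : Fin m → B) : Prop :=
  ∃ W : Fin m → B, IsPartition W ∧ (∀ j, W j ≤ v j) ∧ BoolSat B φ W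

/-! ### Idempotents, stalks and Boolean values -/

/-- The idempotents of `R`. Mathlib's Boolean algebra structure on this type has
`e ∧ f = e * f`, `e ∨ f = e + f - e * f`, `¬ e = 1 - e`, and `e ≤ f` means `e * f = e`. -/
abbrev Idem (R : Type u) [CommRing R] : Type u := {a : R // IsIdempotentElem a}

/-- The stalk `R_e`: the localization of `R` at the powers of the idempotent `e`. -/
abbrev Stalk (R : Type u) [CommRing R] (e : Idem R) : Type u := Localization.Away (e : R)

/-- The tuple `f_e` of images in the stalk `R_e` of a tuple `f` of elements of `R`. -/
def germ {R : Type u} [CommRing R] {n : ℕ} (f : Fin n → R) (e : Idem R) : Fin n → Stalk R e :=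
  fun i => algebraMap R (Stalk R e) (f i)

/-- The idempotent `b` is a Boolean value of `θ(f)`: for every atom `e`, one has
`R_e ⊨ θ(f_e)` if and only if `e ≤ b`. -/
def IsBoolVal (R : Type u) [CommRing R] {n : ℕ} (θ : Language.ring.Formula (Fin n))
    (f : Fin n → R) (b : Idem R) : Prop :=
  ∀ e : Idem R, IsAtom e → (Sat (Stalk R e) θ (germ f e) ↔ e ≤ b)

/-- Axiom 1: the Boolean algebra of idempotents is atomic. -/
def Axiom1 (R : Type u) [CommRing R] : Prop := IsAtomic (Idem R)

/-- Axiom 2: every `θ(f)` has a unique Boolean value. -/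
def Axiom2 (R : Type u) [CommRing R] : Prop :=
  ∀ (n : ℕ) (θ : Language.ring.Formula (Fin n)) (f : Fin n → R), ∃! b : Idem R, IsBoolVal R θ f b

/-- The Boolean value `⟦θ(f)⟧` in a ring that satisfies Axiom 2. -/
noncomputable def boolVal {R : Type u} [CommRing R] (h : Axiom2 R) {n : ℕ}
    (θ : Language.ring.Formula (Fin n)) (f : Fin n → R) : Idem R :=
  (h n θ f).choose

/-- Axiom 3: for all `θ` and `f` there is `g` with `⟦∃ w, θ(f, w)⟧ ≤ ⟦θ(f, g)⟧`. -/
def Axiom3 (R : Type u) [CommRing R] (h : Axiom2 R) : Prop :=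
  ∀ (n : ℕ) (θ : Language.ring.Formula (Fin (n + 1))) (f : Fin n → R),
    ∃ g : R, boolVal h (exLast θ) f ≤ boolVal h θ (Fin.snoc f g)

/-- Axiom 4: for atomic `θ`, one has `R ⊨ θ(f)` if and only if `⟦θ(f)⟧ = 1`. -/
def Axiom4 (R : Type u) [CommRing R] (h : Axiom2 R) : Prop :=
  ∀ (n : ℕ) (θ : Language.ring.Formula (Fin n)),
    FirstOrder.Language.BoundedFormula.IsAtomic θ →
      ∀ f : Fin n → R, Sat R θ f ↔ boolVal h θ f = ⊤

/-- The first four axioms. -/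
structure BasicAxioms (R : Type u) [CommRing R] : Prop where
  ax1 : Axiom1 R
  ax2 : Axiom2 R
  ax3 : Axiom3 R ax2
  ax4 : Axiom4 R ax2

/-- The sequence `θ₀, …, θ_{m-1}` of ring formulas is a partition sequence: in every commutative
ring satisfying Axioms 1 to 4, and for every tuple `f`, the Boolean values `⟦θⱼ(f)⟧` form a
partition of the Boolean algebra of idempotents. -/
def PartitionSeq {m n : ℕ} (θ : Fin m → Language.ring.Formula (Fin n)) : Prop :=
  ∀ (S : Type u) [CommRing S] (h : BasicAxioms S) (f : Fin n → S),
    IsPartition fun j => boolVal h.ax2 (θ j) f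

/-- Axiom 5 (patching): for every formula `φ(v₀, …, v_m)` of Boolean algebras and every partition
sequence `θ₀, …, θ_m` of ring formulas, there is `g` in `R` such that
`φ*(⟦θ₀(f, g)⟧, …, ⟦θ_m(f, g)⟧)` holds if and only if there is a partition `Y` with
`Yⱼ ≤ ⟦∃ w, θⱼ(f, w)⟧` for all `j` such that `φ(Y)` holds. -/
def Axiom5 (R : Type u) [CommRing R] (h : Axiom2 R) : Prop :=
  ∀ (m n : ℕ) (φ : boolLang.Formula (Fin (m + 1)))
    (θ : Fin (m + 1) → Language.ring.Formula (Fin (n + 1))),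
    PartitionSeq.{u} θ → ∀ f : Fin n → R,
      ((∃ g : R, StarSat (Idem R) φ fun j => boolVal h (θ j) (Fin.snoc f g)) ↔
        ∃ Y : Fin (m + 1) → Idem R, IsPartition Y ∧
          (∀ j, Y j ≤ boolVal h (exLast (θ j)) f) ∧ BoolSat (Idem R) φ Y)

/-- `R` is a model of AXIOMS, the five axioms together. -/
structure SatisfiesAxioms (R : Type u) [CommRing R] : Prop extends BasicAxioms R where
  ax5 : Axiom5 R ax2

/-- Connected rings: `0 ≠ 1`, and `0` and `1` are the only idempotents. -/
structure IsConnectedRing (R : Type u) [CommRing R] : Prop where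
  zero_ne_one : (0 : R) ≠ 1
  eq_zero_or_one : ∀ x : R, IsIdempotentElem x → x = 0 ∨ x = 1

end FVRing

namespace FVRing

/-! ### Counting up to a threshold -/

/-! The proof is a Feferman–Vaught analysis. Given finitely many ring formulas ψ and a tuple from R,
colour each atom of 𝔹 by the set of those ψ that hold at its stalk. By `exists_determining_types`,
whether a formula θ holds of a tuple in a model of AXIOMS depends only on how many atoms have each
colour, counted up to a finite threshold; the list ψ and the threshold depend on θ alone.

This goes by induction on θ. Axiom 4 reduces an equation to its truth at all stalks. For a
quantifier, the new list records which colours some choice of the new element can produce at an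
atom. An element of one ring refines the colouring there. Counting copies this refinement to the
other ring, up to a threshold, in such a way that inside each old class all new classes but one are
finite (`exists_imitation`). Finite sets of atoms are cut out by idempotents, hence so is every
class of the copy. Numbers of atoms up to a threshold are expressible in the language of Boolean
algebras, so Axiom 5 yields an element that realizes the copy with the right counts
(`exists_imitating_witness`).

In a product of connected rings the idempotents are the sets of indices, the atoms are the single
indices and the stalks are the factors. Boolean values are therefore truth sets, and witnesses are
chosen coordinatewise, which gives (b). Stalks at atoms are connected, so the product of the stalks
is a model whose atoms and stalks match those of R; all counts agree, which gives (a). For (c), the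
stalks and 𝔹 are interpretable in R, so each instance of AXIOMS is a first-order sentence and passes
along elementary equivalence (`ElemEquiv.satisfiesAxioms`). -/

theorem min_add_congr {k a b a' b' : ℕ∞} (ha : min k a = min k a') (hb : min k b = min k b') :
    min k (a + b) = min k (a' + b') := by
  have key : ∀ x y : ℕ∞, min k (x + y) = min k (min k x + min k y) := by
    intro x y
    rcases le_total k x with hx | hx
    · rw [min_eq_left hx, min_eq_left (hx.trans le_self_add), min_eq_left le_self_add]
    rcases le_total k y with hy | hy
    · rw [min_eq_left hy, min_eq_left (hy.trans le_add_self), min_eq_left le_add_self]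
    rw [min_eq_right hx, min_eq_right hy]
  rw [key a b, key a' b', ha, hb]

theorem encard_preimage_insert {E τ : Type*} [DecidableEq τ] (d : E → τ) {t : τ} {P : Finset τ}
    (ht : t ∉ P) : (d ⁻¹' (insert t P : Finset τ)).encard =
      (d ⁻¹' {t}).encard + (d ⁻¹' P).encard := by
  rw [← Set.encard_union_eq]
  · congr 1; ext x; simp
  · rw [Set.disjoint_left]
    rintro x hx hx'
    simp only [Set.mem_preimage, Set.mem_singleton_iff, Finset.mem_coe] at hx hx'
    exact ht (hx ▸ hx')

/-- Two colourings with the same colours have, for every colour, equally many points of that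
colour, where numbers from `k` on are not distinguished. -/
def CountEquiv {E E' τ : Type*} (k : ℕ) (c : E → τ) (c' : E' → τ) : Prop :=
  ∀ t, min (k : ℕ∞) (c ⁻¹' {t}).encard = min (k : ℕ∞) (c' ⁻¹' {t}).encard

namespace CountEquiv

variable {E E' τ σ : Type*} {k : ℕ} {c : E → τ} {c' : E' → τ}

theorem symm (h : CountEquiv k c c') : CountEquiv k c' c := fun t => (h t).symm

theorem mono {l : ℕ} (h : CountEquiv k c c') (hl : l ≤ k) : CountEquiv l c c' := by
  intro t
  have hl' : (l : ℕ∞) ≤ k := by exact_mod_cast hl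
  have := congr_arg (min (l : ℕ∞)) (h t)
  rwa [← min_assoc, ← min_assoc, min_eq_left hl'] at this

theorem finset_preimage (h : CountEquiv k c c') (P : Finset τ) :
    min (k : ℕ∞) (c ⁻¹' P).encard = min (k : ℕ∞) (c' ⁻¹' P).encard := by
  classical
  induction P using Finset.induction_on with
  | empty => simp
  | insert t P ht ih =>
    rw [encard_preimage_insert c ht, encard_preimage_insert c' ht]
    exact min_add_congr (h t) ih

theorem comp [Finite τ] (h : CountEquiv k c c') (π : τ → σ) : CountEquiv k (π ∘ c) (π ∘ c') := by
  classical
  have := Fintype.ofFinite τ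
  intro s
  convert h.finset_preimage (Finset.univ.filter fun t => π t = s) using 3 <;> ext x <;> simp

/-- A nonzero threshold still tells empty classes from nonempty ones. -/
theorem exists_of_pos (h : CountEquiv k c c') (hk : k ≠ 0) (e' : E') : ∃ e, c e = c' e' := by
  by_contra! hne
  have h0 : c ⁻¹' {c' e'} = ∅ := Set.eq_empty_of_forall_notMem fun e he => hne e he
  have := h (c' e')
  rw [h0, Set.encard_empty, min_eq_right zero_le, eq_comm, min_eq_iff] at this
  rcases this with ⟨h1, -⟩ | ⟨h1, -⟩
  · exact hk (by exact_mod_cast h1)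
  · exact Set.eq_empty_iff_forall_notMem.1 (Set.encard_eq_zero.1 h1) e' rfl

end CountEquiv

theorem min_eq_min_of_le {k a b : ℕ∞} (ha : k ≤ a) (hb : k ≤ b) : min k a = min k b := by
  rw [min_eq_left ha, min_eq_left hb]

/-- A colouring of one set can be imitated, up to a threshold, on another one of the same size up
to a larger threshold, with all colour classes but one finite. -/
theorem exists_imitation {E E' σ : Type*} [Fintype σ] [Nonempty σ] (k : ℕ) (A : Set E)
    (A' : Set E') (d : E → σ)
    (h : min ((k * Fintype.card σ : ℕ) : ℕ∞) A.encard =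
      min ((k * Fintype.card σ : ℕ) : ℕ∞) A'.encard) :
    ∃ d' : E' → σ, (∀ s, min (k : ℕ∞) (A ∩ d ⁻¹' {s}).encard =
      min (k : ℕ∞) (A' ∩ d' ⁻¹' {s}).encard) ∧
      ∃ s₀, ∀ s, s ≠ s₀ → (A' ∩ d' ⁻¹' {s}).Finite := by
  classical
  rcases lt_or_ge A.encard ((k * Fintype.card σ : ℕ) : ℕ∞) with hA | hA
  · have hAA : A.encard = A'.encard := by
      rw [min_eq_right hA.le] at h
      rcases min_choice ((k * Fintype.card σ : ℕ) : ℕ∞) A'.encard with h' | h'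
      · rw [h'] at h; exact absurd h hA.ne
      · rw [h, h']
    have hfin' : A'.Finite := Set.encard_ne_top_iff.1 (hAA ▸ hA.ne_top)
    rcases A'.eq_empty_or_nonempty with rfl | ⟨a, ha⟩
    · rw [Set.encard_empty, Set.encard_eq_zero] at hAA
      subst hAA
      exact ⟨fun _ => Classical.arbitrary σ, by simp, by simp⟩
    have hne : A.Nonempty := by
      rw [← Set.encard_ne_zero, hAA, Set.encard_ne_zero]; exact ⟨a, ha⟩
    have : Nonempty E := ⟨hne.some⟩
    -- Below the threshold both sets are finite of equal size, so the colouring is pulled back along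
    -- a bijection.
    obtain ⟨f, hf⟩ := hfin'.exists_bijOn_of_encard_eq hAA.symm
    refine ⟨d ∘ f, fun s => ?_, Classical.arbitrary σ,
      fun s _ => hfin'.subset Set.inter_subset_left⟩
    have : A ∩ d ⁻¹' {s} = f '' (A' ∩ (d ∘ f) ⁻¹' {s}) := by
      rw [Set.preimage_comp, Set.image_inter_preimage, hf.image_eq]
    rw [this, (hf.injOn.mono Set.inter_subset_left).encard_image]
  · have hA' : ((k * Fintype.card σ : ℕ) : ℕ∞) ≤ A'.encard := by
      rw [min_eq_left hA] at h; rw [h]; exact min_le_right _ _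
    obtain ⟨F, hFA, hF⟩ := Set.exists_subset_encard_eq hA
    have hFfin : F.Finite := Set.encard_ne_top_iff.1 (hF ▸ ENat.natCast_ne_top _)
    lift F to Finset E using hFfin
    rw [Set.encard_coe_eq_coe_finsetCard, Nat.cast_inj] at hF
    -- Pigeonhole on k·|σ| points: some colour s₀ is used at least k times. Its count is saturated,
    -- so it may absorb everything left over in A'.
    obtain ⟨s₀, -, hs₀⟩ := Finset.exists_le_card_fiber_of_mul_le_card_of_maps_to (s := F)
      (t := Finset.univ) (f := d) (n := k) (fun _ _ => Finset.mem_univ _) Finset.univ_nonempty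
      (by rw [hF, Finset.card_univ, mul_comm])
    have hs₀' : (k : ℕ∞) ≤ (A ∩ d ⁻¹' {s₀}).encard := by
      refine le_trans ?_ (Set.encard_le_encard (s := (F.filter fun x => d x = s₀ : Finset E)) ?_)
      · rw [Set.encard_coe_eq_coe_finsetCard]; exact_mod_cast hs₀
      · intro x hx
        simp only [Finset.coe_filter, Set.mem_ofPred_eq] at hx
        exact ⟨hFA hx.1, hx.2⟩
    have hG : ∀ s, ∃ G : Finset E, (G : Set E) ⊆ A ∩ d ⁻¹' {s} ∧
        (G.card : ℕ∞) = min (k : ℕ∞) (A ∩ d ⁻¹' {s}).encard := by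
      intro s
      obtain ⟨G, hGs, hG⟩ := Set.exists_subset_encard_eq
        (min_le_right (k : ℕ∞) (A ∩ d ⁻¹' {s}).encard)
      have hGfin : G.Finite := Set.encard_ne_top_iff.1
        (hG ▸ ((min_le_left _ _).trans_lt (ENat.natCast_lt_top k)).ne)
      lift G to Finset E using hGfin
      exact ⟨G, hGs, by rw [← hG, Set.encard_coe_eq_coe_finsetCard]⟩
    choose G hGs hGc using hG
    have hGk : ∀ s, (G s).card ≤ k := fun s => by
      have : ((G s).card : ℕ∞) ≤ k := hGc s ▸ min_le_left _ _
      exact_mod_cast this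
    -- U samples every colour except s₀, with at most k points each. Omitting s₀ leaves room: once
    -- |U| points of A' are used, at least k remain.
    set U : Finset E := (Finset.univ.erase s₀).biUnion G with hU
    have hUc : U.card + k ≤ k * Fintype.card σ := by
      have h1 : U.card ≤ (Finset.univ.erase s₀).card * k :=
        Finset.card_biUnion_le_card_mul _ _ _ fun s _ => hGk s
      have h2 : (Finset.univ.erase s₀ : Finset σ).card + 1 = Fintype.card σ := by
        rw [Finset.card_erase_add_one (Finset.mem_univ _), Finset.card_univ]
      rw [← h2]; nlinarith
    obtain ⟨H, hHA, hH⟩ := Set.exists_subset_encard_eq (s := A') (k := (U.card : ℕ∞))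
      (le_trans (by exact_mod_cast (Nat.le_of_add_right_le hUc)) hA')
    have hHfin : H.Finite := Set.encard_ne_top_iff.1 (hH ▸ ENat.natCast_ne_top _)
    have hHU : H.encard = (U : Set E).encard := by rw [hH, Set.encard_coe_eq_coe_finsetCard]
    have hbij : ∃ f : E' → σ, ∀ s, s ≠ s₀ → (H ∩ f ⁻¹' {s}).encard = (G s).card := by
      rcases H.eq_empty_or_nonempty with rfl | ⟨a, ha⟩
      · refine ⟨fun _ => s₀, fun s hs => ?_⟩
        rw [Set.encard_empty, eq_comm, Set.encard_eq_zero, Finset.coe_eq_empty] at hHU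
        have : G s = ∅ := Finset.subset_empty.1 (hHU ▸ Finset.subset_biUnion_of_mem G (by simpa))
        simp [this]
      have hne : (U : Set E).Nonempty := by
        rw [← Set.encard_ne_zero, ← hHU, Set.encard_ne_zero]; exact ⟨a, ha⟩
      have : Nonempty E := ⟨hne.some⟩
      obtain ⟨f, hf⟩ := hHfin.exists_bijOn_of_encard_eq hHU
      refine ⟨d ∘ f, fun s hs => ?_⟩
      rw [← (hf.injOn.mono Set.inter_subset_left).encard_image, Set.preimage_comp,
        Set.image_inter_preimage, hf.image_eq, ← Set.encard_coe_eq_coe_finsetCard]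
      congr 1
      ext x
      simp only [hU, Finset.coe_biUnion, Set.mem_inter_iff, Set.mem_iUnion, Set.mem_preimage,
        Set.mem_singleton_iff, Finset.mem_coe, Finset.mem_erase, Finset.mem_univ, and_true]
      constructor
      · rintro ⟨⟨s', -, hx⟩, rfl⟩
        have := (hGs s' hx).2
        simp only [Set.mem_preimage, Set.mem_singleton_iff] at this
        rwa [this]
      · exact fun hx => ⟨⟨s, hs, hx⟩, (hGs s hx).2⟩
    obtain ⟨f, hf⟩ := hbij
    have hfib : ∀ s, s ≠ s₀ →
        A' ∩ (fun x => if x ∈ H then f x else s₀) ⁻¹' {s} = H ∩ f ⁻¹' {s} := by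
      intro s hs
      ext x
      by_cases hx : x ∈ H
      · simp [hx, hHA hx]
      · simp [hx, hs.symm]
    -- Only the finite set H imitates the sample; the rest of A' gets colour s₀, which keeps every
    -- other class finite.
    refine ⟨fun x => if x ∈ H then f x else s₀, fun s => ?_, s₀, fun s hs => ?_⟩
    · by_cases hs : s = s₀
      · subst hs
        refine min_eq_min_of_le hs₀' ?_
        have h1 : (A' \ H) ⊆ A' ∩ (fun x => if x ∈ H then f x else s) ⁻¹' {s} := by
          rintro x ⟨hx, hx'⟩
          simp [hx, hx']
        refine le_trans ?_ (Set.encard_le_encard h1)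
        have h2 := Set.encard_sdiff_add_encard_of_subset hHA
        rw [hH] at h2
        have h3 : ((U.card + k : ℕ) : ℕ∞) ≤ A'.encard := le_trans (by exact_mod_cast hUc) hA'
        rw [← h2, add_comm, Nat.cast_add] at h3
        exact (ENat.add_le_add_iff_right (ENat.natCast_ne_top _)).1
          (by rwa [add_comm (k : ℕ∞), add_comm])
      · rw [hfib s hs, hf s hs, hGc s, ← min_assoc, min_self]
    · rw [hfib s hs]; exact hHfin.subset Set.inter_subset_left

/-- The refinement of a colouring can be imitated on another set. -/
theorem CountEquiv.exists_refinement {E E' τ σ : Type*} [Fintype σ] [Nonempty σ] {k : ℕ}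
    {c : E → τ} {c' : E' → τ} (h : CountEquiv (k * Fintype.card σ) c c') (d : E → σ) :
    ∃ d' : E' → σ, CountEquiv k (fun e => (c e, d e)) (fun e => (c' e, d' e)) ∧
      ∀ t, ∃ s₀, ∀ s, s ≠ s₀ → (c' ⁻¹' {t} ∩ d' ⁻¹' {s}).Finite := by
  -- Each class of the old colouring is treated separately, and the results are glued along c'.
  choose D hD hfin using fun t => exists_imitation k (c ⁻¹' {t}) (c' ⁻¹' {t}) d (h t)
  have hDt : ∀ t s, c' ⁻¹' {t} ∩ (fun e => D (c' e) e) ⁻¹' {s} = c' ⁻¹' {t} ∩ D t ⁻¹' {s} := by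
    intro t s
    ext x
    simp only [Set.mem_inter_iff, Set.mem_preimage, Set.mem_singleton_iff]
    constructor <;> rintro ⟨rfl, h2⟩ <;> exact ⟨rfl, h2⟩
  refine ⟨fun e => D (c' e) e, ?_, fun t => ?_⟩
  · rintro ⟨t, s⟩
    convert hD t s using 3
    · ext x; simp
    · rw [← hDt]; ext x; simp
  · simpa only [hDt] using hfin t

/-! ### Uniform definability over a class of structures -/

section Definability

variable {L : FirstOrder.Language.{0, 0}} {X : Type*} {M : X → Type*} [∀ x, L.Structure (M x)]
  {α β : Type}

variable (L) in
/-- A family of functions, one on each structure of a class, that is given by a single term. -/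
def TermDef (F : ∀ x, (α → M x) → M x) : Prop :=
  ∃ t : L.Term α, ∀ x f, t.realize f = F x f

variable (L) in
/-- A family of relations, one on each structure of a class, that is given by a single formula. -/
def UDef (P : ∀ x, (α → M x) → Prop) : Prop :=
  ∃ φ : L.Formula α, ∀ x f, φ.Realize f ↔ P x f

theorem TermDef.var (a : α) : TermDef L (M := M) fun _ f => f a :=
  ⟨.var a, fun _ _ => rfl⟩

theorem UDef.eq {F G : ∀ x, (α → M x) → M x} (hF : TermDef L F) (hG : TermDef L G) :
    UDef L fun x f => F x f = G x f := by
  obtain ⟨t, ht⟩ := hF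
  obtain ⟨s, hs⟩ := hG
  exact ⟨t.equal s, fun x f => by rw [Language.Formula.realize_equal, ht, hs]⟩

namespace UDef

variable {P Q : ∀ x, (α → M x) → Prop}

theorem congr (h : UDef L P) (hPQ : ∀ x f, P x f ↔ Q x f) : UDef L Q := by
  obtain ⟨φ, hφ⟩ := h
  exact ⟨φ, fun x f => (hφ x f).trans (hPQ x f)⟩

protected theorem not (h : UDef L P) : UDef L fun x f => ¬ P x f := by
  obtain ⟨φ, hφ⟩ := h
  exact ⟨φ.not, fun x f => by rw [Language.Formula.realize_not, hφ]⟩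

theorem imp (h : UDef L P) (h' : UDef L Q) : UDef L fun x f => P x f → Q x f := by
  obtain ⟨φ, hφ⟩ := h
  obtain ⟨ψ, hψ⟩ := h'
  exact ⟨Language.BoundedFormula.imp φ ψ, fun x f => by
    rw [Language.Formula.realize_imp, hφ, hψ]⟩

protected theorem and (h : UDef L P) (h' : UDef L Q) : UDef L fun x f => P x f ∧ Q x f :=
  (h.imp h'.not).not.congr fun x f => by tauto

protected theorem or (h : UDef L P) (h' : UDef L Q) : UDef L fun x f => P x f ∨ Q x f :=
  (h.not.imp h').congr fun x f => by tauto

theorem iff (h : UDef L P) (h' : UDef L Q) : UDef L fun x f => (P x f ↔ Q x f) :=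
  ((h.imp h').and (h'.imp h)).congr fun x f => by tauto

/-- Since p does not depend on the structure, it is decided outside the logic. This lets fixed data,
such as prescribed counts, enter formulas. -/
theorem const (p : Prop) : UDef L (M := M) (α := α) fun _ _ => p := by
  by_cases hp : p
  · exact ⟨⊤, fun x f => by simp [hp]⟩
  · exact ⟨⊥, fun x f => by simp [hp]⟩

theorem finAll {ι : Type*} [Finite ι] {P : ι → ∀ x, (α → M x) → Prop} (h : ∀ i, UDef L (P i)) :
    UDef L fun x f => ∀ i, P i x f := by
  classical
  have := Fintype.ofFinite ι
  have key : ∀ s : Finset ι, UDef L fun x f => ∀ i ∈ s, P i x f := by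
    intro s
    induction s using Finset.induction_on with
    | empty => exact (const True).congr fun x f => by simp
    | insert a s _ ih => exact ((h a).and ih).congr fun x f => by simp
  exact (key Finset.univ).congr fun x f => by simp

theorem subst {P : ∀ x, (β → M x) → Prop} (h : UDef L P) {F : β → ∀ x, (α → M x) → M x}
    (hF : ∀ b, TermDef L (F b)) : UDef L fun x f => P x fun b => F b x f := by
  obtain ⟨φ, hφ⟩ := h
  choose t ht using hF
  refine ⟨Language.BoundedFormula.subst φ t, fun x f => ?_⟩
  refine Language.BoundedFormula.realize_subst.trans ?_
  simp only [ht]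
  exact hφ x _

theorem relabel {P : ∀ x, (β → M x) → Prop} (h : UDef L P) (ρ : β → α) :
    UDef L fun x f => P x fun b => f (ρ b) :=
  h.subst fun b => .var (ρ b)

theorem all [Finite β] {P : ∀ x, (α → M x) → (β → M x) → Prop}
    (h : UDef L fun x (f : α ⊕ β → M x) => P x (fun a => f (.inl a)) fun b => f (.inr b)) :
    UDef L fun x f => ∀ g, P x f g := by
  obtain ⟨φ, hφ⟩ := h
  exact ⟨φ.iAlls β, fun x f => by simp only [Language.Formula.realize_iAlls, hφ, Sum.elim_inl,
    Sum.elim_inr]⟩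

theorem all_elem {P : ∀ x, (α → M x) → M x → Prop}
    (h : UDef L fun x (f : α ⊕ Unit → M x) => P x (fun a => f (.inl a)) (f (.inr ()))) :
    UDef L fun x f => ∀ a, P x f a :=
  (all (P := fun x f (g : Unit → M x) => P x f (g ())) h).congr fun _ _ =>
    ⟨fun H a => H fun _ => a, fun H g => H (g ())⟩

theorem ex_elem {P : ∀ x, (α → M x) → M x → Prop}
    (h : UDef L fun x (f : α ⊕ Unit → M x) => P x (fun a => f (.inl a)) (f (.inr ()))) :
    UDef L fun x f => ∃ a, P x f a :=
  (all_elem (P := fun x f a => ¬ P x f a) h.not).not.congr fun x f => by simp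

end UDef

end Definability

/-! ### Atomic Boolean algebras -/

/-- The atoms of a Boolean algebra. -/
abbrev Atoms (B : Type*) [BooleanAlgebra B] := {e : B // IsAtom e}

section Atomic

variable {B : Type*} [BooleanAlgebra B]

theorem atom_le_compl_iff {e : B} (he : IsAtom e) {b : B} : e ≤ bᶜ ↔ ¬ e ≤ b := by
  rw [he.not_le_iff_disjoint, le_compl_iff_disjoint_right]

theorem atom_le_sup_iff {e : B} (he : IsAtom e) {a b : B} : e ≤ a ⊔ b ↔ e ≤ a ∨ e ≤ b := by
  have h := atom_le_compl_iff he (b := aᶜ ⊓ bᶜ)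
  rw [compl_inf, compl_compl, compl_compl, le_inf_iff, atom_le_compl_iff he,
    atom_le_compl_iff he] at h
  tauto

theorem atom_le_finset_sup_iff {e : B} (he : IsAtom e) {ι : Type*} {s : Finset ι} {Y : ι → B} :
    e ≤ s.sup Y ↔ ∃ i ∈ s, e ≤ Y i := by
  classical
  induction s using Finset.induction_on with
  | empty => simpa using he.1
  | insert a s _ ih => simp [atom_le_sup_iff he, ih]

theorem le_of_forall_atom_le [IsAtomic B] {a b : B} (h : ∀ e : Atoms B, e.1 ≤ a → e.1 ≤ b) :
    a ≤ b := by
  by_contra hab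
  rcases eq_bot_or_exists_atom_le (a ⊓ bᶜ) with h0 | ⟨e, he, hle⟩
  · exact hab (by rwa [← disjoint_iff, disjoint_compl_right_iff] at h0)
  · exact (atom_le_compl_iff he).1 (hle.trans inf_le_right) (h ⟨e, he⟩ (hle.trans inf_le_left))

theorem eq_of_forall_atom_le_iff [IsAtomic B] {a b : B}
    (h : ∀ e : Atoms B, e.1 ≤ a ↔ e.1 ≤ b) : a = b :=
  le_antisymm (le_of_forall_atom_le fun e => (h e).1) (le_of_forall_atom_le fun e => (h e).2)

theorem eq_top_iff_forall_atom_le [IsAtomic B] {a : B} : a = ⊤ ↔ ∀ e : Atoms B, e.1 ≤ a :=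
  ⟨fun h e => h ▸ le_top, fun h => eq_of_forall_atom_le_iff fun e => by simp [h e]⟩

theorem isPartition_iff [IsAtomic B] {m : ℕ} {Y : Fin m → B} :
    IsPartition Y ↔ ∀ e : Atoms B, ∃! j, e.1 ≤ Y j := by
  constructor
  · rintro ⟨h1, h2⟩ e
    obtain ⟨j, -, hj⟩ := (atom_le_finset_sup_iff e.2).1 (eq_top_iff_forall_atom_le.1 h1 e)
    refine ⟨j, hj, fun i hi => ?_⟩
    by_contra hij
    exact e.2.1 (le_bot_iff.1 (h2 i j hij ▸ le_inf hi hj))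
  · intro h
    refine ⟨eq_top_iff_forall_atom_le.2 fun e => (atom_le_finset_sup_iff e.2).2 ?_,
      fun i j hij => le_bot_iff.1 (le_of_forall_atom_le fun e he => ?_)⟩
    · obtain ⟨j, hj, -⟩ := h e
      exact ⟨j, Finset.mem_univ _, hj⟩
    · exact absurd ((h e).unique (he.trans inf_le_left) (he.trans inf_le_right)) hij

/-- An atom lies in exactly one piece of each partition, so the inclusions leave no freedom.
Consequently φ* agrees with φ on values that already form a partition. -/
theorem IsPartition.eq_of_le [IsAtomic B] {m : ℕ} {W V : Fin m → B} (hW : IsPartition W)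
    (hV : IsPartition V) (h : ∀ j, W j ≤ V j) : W = V := by
  rw [isPartition_iff] at hW hV
  funext j
  refine le_antisymm (h j) (le_of_forall_atom_le fun e he => ?_)
  obtain ⟨i, hi, -⟩ := hW e
  rwa [(hV e).unique he (hi.trans (h i))]

/-- The sets of atoms of the form `{e | e ≤ b}`. -/
def Representable (A : Set (Atoms B)) : Prop := ∃ b : B, ∀ e : Atoms B, e ∈ A ↔ e.1 ≤ b

namespace Representable

variable {A A' : Set (Atoms B)}

theorem compl (h : Representable A) : Representable Aᶜ := by
  obtain ⟨b, hb⟩ := h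
  exact ⟨bᶜ, fun e => by rw [Set.mem_compl_iff, hb, atom_le_compl_iff e.2]⟩

theorem union (h : Representable A) (h' : Representable A') : Representable (A ∪ A') := by
  obtain ⟨b, hb⟩ := h
  obtain ⟨b', hb'⟩ := h'
  exact ⟨b ⊔ b', fun e => by rw [Set.mem_union, hb, hb', atom_le_sup_iff e.2]⟩

theorem inter (h : Representable A) (h' : Representable A') : Representable (A ∩ A') := by
  have := (h.compl.union h'.compl).compl
  rwa [Set.compl_union, compl_compl, compl_compl] at this

theorem iUnion {ι : Type*} [Finite ι] {A : ι → Set (Atoms B)} (h : ∀ i, Representable (A i)) :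
    Representable (⋃ i, A i) := by
  have := Fintype.ofFinite ι
  choose b hb using h
  exact ⟨Finset.univ.sup b, fun e => by simp [hb, atom_le_finset_sup_iff e.2]⟩

theorem singleton (e : Atoms B) : Representable {e} :=
  ⟨e.1, fun e' => by
    rw [Set.mem_singleton_iff]
    refine ⟨fun h => h ▸ le_rfl, fun h => Subtype.ext ((e.2.le_iff.1 h).resolve_left e'.2.1)⟩⟩

theorem of_finite (h : A.Finite) : Representable A := by
  have := h.to_subtype
  have h' := iUnion fun a : A => singleton a.1
  rwa [Set.iUnion_of_singleton_coe] at h'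

end Representable

/-- The number of atoms below an element. -/
noncomputable def atomCount (b : B) : ℕ∞ := {e : Atoms B | e.1 ≤ b}.encard

/-- Removing one atom lowers the count by one; this recursion makes each lower bound on the count
first-order. -/
theorem succ_le_atomCount_iff {b : B} {i : ℕ} :
    ((i + 1 : ℕ) : ℕ∞) ≤ atomCount b ↔
      ∃ x : B, IsAtom x ∧ x ≤ b ∧ (i : ℕ∞) ≤ atomCount (b ⊓ xᶜ) := by
  have key : ∀ x : Atoms B, x.1 ≤ b → atomCount (b ⊓ x.1ᶜ) + 1 = atomCount b := by
    intro x hx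
    have hx' : x ∈ {e : Atoms B | e.1 ≤ b} := hx
    rw [atomCount, atomCount, ← Set.encard_sdiff_singleton_add_one hx']
    congr 2
    ext e
    have : e.1 ≤ x.1 ↔ e = x :=
      ⟨fun h => Subtype.ext ((x.2.le_iff.1 h).resolve_left e.2.1), fun h => h ▸ le_rfl⟩
    simp [atom_le_compl_iff e.2, this]
  constructor
  · intro h
    have hne : atomCount b ≠ 0 := by
      intro h0
      rw [h0] at h
      exact absurd h (by simp)
    obtain ⟨x, hx⟩ := Set.encard_ne_zero.1 hne
    refine ⟨x.1, x.2, hx, ?_⟩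
    rw [← key x hx, Nat.cast_add, Nat.cast_one] at h
    exact (ENat.add_le_add_iff_right (by simp)).1 h
  · rintro ⟨x, hx, hxb, h⟩
    rw [← key ⟨x, hx⟩ hxb, Nat.cast_add, Nat.cast_one]
    gcongr

end Atomic

/-- This breaks agreement up to a threshold into finitely many lower bounds, each of them definable.
-/
theorem min_eq_min_iff {k : ℕ} {a b : ℕ∞} :
    min (k : ℕ∞) a = min (k : ℕ∞) b ↔
      ∀ i : Fin (k + 1), ((i : ℕ) : ℕ∞) ≤ a ↔ ((i : ℕ) : ℕ∞) ≤ b := by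
  constructor
  · intro h i
    have hi : ((i : ℕ) : ℕ∞) ≤ k := by exact_mod_cast Nat.lt_succ_iff.1 i.2
    have := congr_arg (fun z => ((i : ℕ) : ℕ∞) ≤ z) h
    simpa [hi] using this
  · intro h
    have key : ∀ {a b : ℕ∞}, (∀ i : Fin (k + 1), ((i : ℕ) : ℕ∞) ≤ a → ((i : ℕ) : ℕ∞) ≤ b) →
        min (k : ℕ∞) a ≤ min (k : ℕ∞) b := by
      intro a b h
      refine le_min (min_le_left _ _) ?_
      have hfin : min (k : ℕ∞) a ≠ ⊤ := ((min_le_left _ _).trans_lt (ENat.natCast_lt_top k)).ne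
      lift min (k : ℕ∞) a to ℕ using hfin with i hi
      have hik : i ≤ k := by exact_mod_cast hi.le.trans (min_le_left _ _)
      exact h ⟨i, Nat.lt_succ_of_le hik⟩ (hi.le.trans (min_le_right _ _))
    exact le_antisymm (key fun i => (h i).1) (key fun i => (h i).2)

/-! ### Counting atoms is definable -/

section BoolDefinability

instance (B : BoolAlg.{u}) : boolLang.Structure B := boolStructure B

variable {α : Type} {F G : ∀ B : BoolAlg.{u}, (α → B) → B}

theorem TermDef.bot : TermDef boolLang fun (B : BoolAlg.{u}) (_ : α → B) => (⊥ : B) :=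
  ⟨.func (L := boolLang) BoolFunc.bot ![], fun _ _ => rfl⟩

theorem TermDef.inf (hF : TermDef boolLang F) (hG : TermDef boolLang G) :
    TermDef boolLang fun B f => F B f ⊓ G B f := by
  obtain ⟨t, ht⟩ := hF
  obtain ⟨s, hs⟩ := hG
  exact ⟨.func (L := boolLang) BoolFunc.inf ![t, s], fun B f => congr_arg₂ _ (ht B f) (hs B f)⟩

theorem TermDef.compl (hF : TermDef boolLang F) : TermDef boolLang fun B f => (F B f)ᶜ := by
  obtain ⟨t, ht⟩ := hF
  exact ⟨.func (L := boolLang) BoolFunc.compl ![t], fun B f => congr_arg _ (ht B f)⟩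

theorem UDef.le (hF : TermDef boolLang F) (hG : TermDef boolLang G) :
    UDef boolLang fun B f => F B f ≤ G B f :=
  (UDef.eq (hF.inf hG) hF).congr fun _ _ => inf_eq_left

theorem uDef_isAtom (a : α) : UDef boolLang fun (B : BoolAlg.{u}) (f : α → B) => IsAtom (f a) := by
  have h : UDef boolLang fun (B : BoolAlg.{u}) (f : α → B) =>
      f a ≠ ⊥ ∧ ∀ y : B, y ≤ f a → y = ⊥ ∨ y = f a :=
    (UDef.eq (.var a) .bot).not.and <| UDef.all_elem <|
      (UDef.le (.var _) (.var _)).imp <|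
        (UDef.eq (.var _) .bot).or (UDef.eq (.var _) (.var _))
  refine h.congr fun B f => ?_
  constructor
  · rintro ⟨h1, h2⟩
    exact ⟨h1, fun y hy => (h2 y hy.le).resolve_right hy.ne⟩
  · exact fun h => ⟨h.1, fun y hy => h.le_iff.1 hy⟩

theorem uDef_le_atomCount (i : ℕ) :
    UDef boolLang fun (B : BoolAlg.{u}) (f : Unit → B) => (i : ℕ∞) ≤ atomCount (f ()) := by
  induction i with
  | zero => exact (UDef.const True).congr fun B f => by simp
  | succ i ih =>
    have h' : UDef boolLang fun (B : BoolAlg.{u}) (f : Unit ⊕ Unit → B) =>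
        (i : ℕ∞) ≤ atomCount (f (.inl ()) ⊓ (f (.inr ()))ᶜ) :=
      ih.subst (F := fun _ B (f : Unit ⊕ Unit → B) => f (.inl ()) ⊓ (f (.inr ()))ᶜ)
        fun _ => (TermDef.var _).inf (TermDef.var _).compl
    have h : UDef boolLang fun (B : BoolAlg.{u}) (f : Unit → B) =>
        ∃ x : B, IsAtom x ∧ x ≤ f () ∧ (i : ℕ∞) ≤ atomCount (f () ⊓ xᶜ) :=
      UDef.ex_elem <| (uDef_isAtom _).and <| (UDef.le (.var _) (.var _)).and h'
    exact h.congr fun B f => succ_le_atomCount_iff.symm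

/-- A formula of Boolean algebras that prescribes numbers of atoms up to a threshold. -/
theorem exists_formula_atomCount (k m : ℕ) (n : Fin m → ℕ∞) :
    ∃ φ : boolLang.Formula (Fin m), ∀ (B : Type u) [BooleanAlgebra B] (y : Fin m → B),
      BoolSat B φ y ↔ ∀ j, min (k : ℕ∞) (n j) = min (k : ℕ∞) (atomCount (y j)) := by
  have h : UDef boolLang fun (B : BoolAlg.{u}) (y : Fin m → B) =>
      ∀ j, min (k : ℕ∞) (n j) = min (k : ℕ∞) (atomCount (y j)) := by
    simp only [min_eq_min_iff]
    exact UDef.finAll fun j => UDef.finAll fun i => (UDef.const _).iff <|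
      (uDef_le_atomCount i).relabel fun _ => j
  obtain ⟨φ, hφ⟩ := h
  exact ⟨φ, fun B _ y => hφ (.of B) y⟩

end BoolDefinability

/-! ### Satisfaction in rings and stalks -/

section Sat

variable {R : Type u} [CommRing R] {n : ℕ}

theorem sat_not {θ : Language.ring.Formula (Fin n)} {f : Fin n → R} :
    Sat R θ.not f ↔ ¬ Sat R θ f := Iff.rfl

/-- The formula saying that exactly the formulas `ψ i` with `i ∈ T` hold. -/
noncomputable def typeFormula {ι : Type} [Finite ι] (ψ : ι → Language.ring.Formula (Fin n))
    (T : Set ι) : Language.ring.Formula (Fin n) :=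
  open Classical in Language.Formula.iInf fun i => if i ∈ T then ψ i else (ψ i).not

theorem sat_typeFormula {ι : Type} [Finite ι] {ψ : ι → Language.ring.Formula (Fin n)}
    {T : Set ι} {f : Fin n → R} :
    Sat R (typeFormula ψ T) f ↔ {i | Sat R (ψ i) f} = T := by
  classical
  let _ := ringStructure R
  refine Language.Formula.realize_iInf.trans ?_
  rw [Set.ext_iff]
  refine forall_congr' fun i => ?_
  by_cases hi : i ∈ T
  · simp only [hi, if_true, iff_true]; rfl
  · simp only [hi, if_false, iff_false]; exact sat_not

theorem stalk_surjective (e : Idem R) : Function.Surjective (algebraMap R (Stalk R e)) :=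
  IsLocalization.Away.algebraMap_surjective_of_isIdempotentElem _ e.2

/-- All positive powers of e equal e, so one multiplication by e decides equality in the stalk. -/
theorem stalk_eq_iff (e : Idem R) {a b : R} :
    algebraMap R (Stalk R e) a = algebraMap R (Stalk R e) b ↔ (e : R) * a = e * b := by
  rw [IsLocalization.eq_iff_exists (Submonoid.powers (e : R))]
  constructor
  · rintro ⟨⟨_, k, rfl⟩, h⟩
    have h' := congr_arg (fun z => (e : R) * z) h
    simp only [← mul_assoc, ← pow_succ'] at h'
    rwa [e.2.pow_succ_eq] at h'
  · exact fun h => ⟨⟨e, Submonoid.mem_powers _⟩, h⟩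

theorem germ_snoc (f : Fin n → R) (g : R) (e : Idem R) :
    germ (Fin.snoc f g) e = Fin.snoc (α := fun _ => Stalk R e) (germ f e) (algebraMap R _ g) := by
  funext i
  refine Fin.lastCases ?_ (fun i => ?_) i <;> simp [germ]

theorem sat_stalk_exLast (θ : Language.ring.Formula (Fin (n + 1))) (f : Fin n → R) (e : Idem R) :
    Sat (Stalk R e) (exLast θ) (germ f e) ↔
      ∃ g : R, Sat (Stalk R e) θ (germ (Fin.snoc f g) e) := by
  simp only [sat_exLast, germ_snoc]
  exact (stalk_surjective e).exists

theorem atom_le_boolVal_iff (h : Axiom2 R) {θ : Language.ring.Formula (Fin n)} {f : Fin n → R}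
    (e : Atoms (Idem R)) : e.1 ≤ boolVal h θ f ↔ Sat (Stalk R e.1) θ (germ f e.1) :=
  ((h n θ f).choose_spec.1 e.1 e.2).symm

theorem boolVal_eq_iff (h : Axiom2 R) {θ : Language.ring.Formula (Fin n)} {f : Fin n → R}
    {b : Idem R} : boolVal h θ f = b ↔ IsBoolVal R θ f b :=
  ⟨fun hb => hb ▸ (h n θ f).choose_spec.1, fun hb => ((h n θ f).choose_spec.2 b hb).symm⟩

/-- The set of those formulas `ψ i` that hold in the stalk at a given atom. -/
def stalkType {ι : Type} (ψ : ι → Language.ring.Formula (Fin n)) (f : Fin n → R)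
    (e : Atoms (Idem R)) : Set ι :=
  {i | Sat (Stalk R e.1) (ψ i) (germ f e.1)}

theorem atom_le_boolVal_typeFormula_iff (h : Axiom2 R) {ι : Type} [Finite ι]
    {ψ : ι → Language.ring.Formula (Fin n)} {T : Set ι} {f : Fin n → R} (e : Atoms (Idem R)) :
    e.1 ≤ boolVal h (typeFormula ψ T) f ↔ stalkType ψ f e = T := by
  rw [atom_le_boolVal_iff, sat_typeFormula, stalkType]

theorem isPartition_typeFormula (h : BasicAxioms R) {ι : Type} [Finite ι]
    (ψ : ι → Language.ring.Formula (Fin n)) {m : ℕ} (ε : Fin m ≃ Set ι) (f : Fin n → R) :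
    IsPartition fun j => boolVal h.ax2 (typeFormula ψ (ε j)) f := by
  have : IsAtomic (Idem R) := h.ax1
  rw [isPartition_iff]
  intro e
  refine ⟨ε.symm (stalkType ψ f e), ?_, fun j hj => ?_⟩
  · exact (atom_le_boolVal_typeFormula_iff h.ax2 e).2 (ε.apply_symm_apply _).symm
  · rw [(atom_le_boolVal_typeFormula_iff h.ax2 e).1 hj, ε.symm_apply_apply]

/-- The colour after adjoining g is among those recorded as attainable over f, with g itself as
witness. -/
theorem stalkType_snoc_mem {ι : Type} [Finite ι] (ψ : ι → Language.ring.Formula (Fin (n + 1)))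
    (f : Fin n → R) (g : R) (e : Atoms (Idem R)) :
    stalkType ψ (Fin.snoc f g) e ∈ stalkType (fun T => exLast (typeFormula ψ T)) f e :=
  (sat_stalk_exLast _ _ _).2 ⟨g, sat_typeFormula.2 rfl⟩

end Sat

/-! ### The Feferman–Vaught analysis -/

/-- Within one class of c, every piece except one is finite, hence a finite join of atoms; the
exceptional piece is what remains of the class. The finitely many classes are then united. -/
theorem representable_imitation {B : Type*} [BooleanAlgebra B] {τ σ : Type*} [Finite τ] [Finite σ]
    {c : Atoms B → τ} {d : Atoms B → σ} (hc : ∀ t, Representable (c ⁻¹' {t}))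
    (h : ∀ t, ∃ s₀, ∀ s, s ≠ s₀ → (c ⁻¹' {t} ∩ d ⁻¹' {s}).Finite) (s : σ) :
    Representable (d ⁻¹' {s}) := by
  have key : ∀ t, Representable (c ⁻¹' {t} ∩ d ⁻¹' {s}) := by
    intro t
    obtain ⟨s₀, hs₀⟩ := h t
    by_cases hs : s = s₀
    · subst hs
      have h1 : Representable (⋃ s' : {s' // s' ≠ s}, c ⁻¹' {t} ∩ d ⁻¹' {s'.1}) :=
        .iUnion fun s' => .of_finite (hs₀ s'.1 s'.2)
      convert (hc t).inter h1.compl using 1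
      ext e
      simp only [Set.mem_inter_iff, Set.mem_preimage, Set.mem_singleton_iff, Set.mem_compl_iff,
        Set.mem_iUnion, not_exists, Subtype.forall]
      constructor
      · rintro ⟨h1, h2⟩
        exact ⟨h1, fun s' hs' h3 => hs' (h3.2.symm.trans h2)⟩
      · rintro ⟨h1, h2⟩
        exact ⟨h1, by_contra fun h3 => h2 _ h3 ⟨h1, rfl⟩⟩
    · exact .of_finite (hs₀ s hs)
  convert Representable.iUnion key using 1
  ext e
  simp

/-- The back-and-forth step. The colouring produced by g is copied to the atoms of R', the copy is
represented by a partition Y of idempotents, and Axiom 5 is applied to Y with a φ that prescribes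
the numbers of atoms. -/
theorem exists_imitating_witness {R R' : Type u} [CommRing R] [CommRing R']
    (h' : SatisfiesAxioms R') {n : ℕ} {ι : Type} [Finite ι] [Fintype (Set ι)]
    (ψ : ι → Language.ring.Formula (Fin (n + 1)))
    (k : ℕ) {f : Fin n → R} {f' : Fin n → R'}
    (hc : CountEquiv ((k + 1) * Fintype.card (Set ι))
      (stalkType (fun T : Set ι => exLast (typeFormula ψ T)) f)
      (stalkType (fun T : Set ι => exLast (typeFormula ψ T)) f')) (g : R) :
    ∃ g' : R', CountEquiv k (stalkType ψ (Fin.snoc f g)) (stalkType ψ (Fin.snoc f' g')) := by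
  classical
  have hatomic : IsAtomic (Idem R') := h'.ax1
  -- The threshold k + 1 is nonzero even when k = 0. Hence each pair of old and new colours
  -- occurring in R' also occurs in R, and so the copied colour is attainable over f'.
  obtain ⟨d', hd', hfin⟩ :=
    CountEquiv.exists_refinement (σ := Set ι) (k := k + 1) hc (stalkType ψ (Fin.snoc f g))
  have hmem : ∀ e', d' e' ∈ stalkType (fun T : Set ι => exLast (typeFormula ψ T)) f' e' := by
    intro e'
    obtain ⟨e, he⟩ := hd'.exists_of_pos k.succ_ne_zero e'
    obtain ⟨h1, h2⟩ := Prod.mk.inj he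
    have h3 := stalkType_snoc_mem ψ f g e
    rwa [h1, h2] at h3
  have hrep := representable_imitation (fun t => ⟨boolVal h'.ax2 (typeFormula _ t) f',
    fun e => (atom_le_boolVal_typeFormula_iff h'.ax2 e).symm⟩) hfin
  choose Y hY using hrep
  simp only [Set.mem_preimage, Set.mem_singleton_iff] at hY
  obtain ⟨m, hm⟩ := Nat.exists_eq_succ_of_ne_zero (Fintype.card_ne_zero (α := Set ι))
  let ε : Fin (m + 1) ≃ Set ι := (Fintype.equivFinOfCardEq hm).symm
  obtain ⟨φ, hφ⟩ := exists_formula_atomCount.{u} k (m + 1)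
    fun j => (stalkType ψ (Fin.snoc f g) ⁻¹' {ε j}).encard
  obtain ⟨g', W, hW, hWle, hWφ⟩ := (h'.ax5 m n φ (fun j => typeFormula ψ (ε j))
    (fun S _ hS => isPartition_typeFormula hS ψ ε) f').2 (by
      refine ⟨fun j => Y (ε j), isPartition_iff.2 fun e => ?_,
        fun j => le_of_forall_atom_le fun e he => ?_, (hφ _ _).2 fun j => ?_⟩
      · simp only [← hY]
        exact ⟨ε.symm (d' e), by simp, fun j hj => by simp [hj]⟩
      · rw [atom_le_boolVal_iff, ← (hY _ e).2 he]
        exact hmem e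
      · have h1 := (hd'.mono k.le_succ).comp Prod.snd (ε j)
        rw [atomCount]
        simp only [← hY]
        exact h1)
  refine ⟨g', fun T => ?_⟩
  obtain ⟨j, rfl⟩ := ε.surjective T
  -- The values of the type formulas form a partition themselves, so W coincides with them and φ
  -- speaks about the actual counts.
  rw [hW.eq_of_le (isPartition_typeFormula h'.toBasicAxioms ψ ε _) hWle, hφ] at hWφ
  rw [hWφ j, atomCount]
  simp only [atom_le_boolVal_typeFormula_iff]
  rfl

/-- Satisfaction of a formula in a ring, the free variables being bound variables not yet
quantified. -/
def BSat (R : Type u) [CommRing R] {n : ℕ} (θ : Language.ring.BoundedFormula Empty n)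
    (f : Fin n → R) : Prop :=
  letI := ringStructure R
  θ.Realize default f

theorem elemEquiv_iff {R S : Type u} [CommRing R] [CommRing S] :
    ElemEquiv R S ↔ ∀ θ : Language.ring.Sentence, BSat R θ default ↔ BSat S θ default := by
  let _ := ringStructure R
  let _ := ringStructure S
  exact Language.elementarilyEquivalent_iff

/-- Truth of a formula in a model of the axioms is determined by the numbers, up to a threshold, of
atoms at whose stalks given combinations of finitely many formulas hold. -/
theorem exists_determining_types {n : ℕ} (θ : Language.ring.BoundedFormula Empty n) :
    ∃ (ι : Type) (_ : Finite ι) (ψ : ι → Language.ring.Formula (Fin n)) (k : ℕ),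
      ∀ (R R' : Type u) [CommRing R] [CommRing R'], SatisfiesAxioms R → SatisfiesAxioms R' →
        ∀ (f : Fin n → R) (f' : Fin n → R'), CountEquiv k (stalkType ψ f) (stalkType ψ f') →
          (BSat R θ f → BSat R' θ f') := by
  induction θ with
  | falsum => exact ⟨Empty, inferInstance, Empty.elim, 0, fun R R' _ _ _ _ f f' _ h => h⟩
  | @equal n t₁ t₂ =>
    -- The not yet quantified variables become free ones, so that Axiom 4 applies.
    let r : Empty ⊕ Fin n → Fin n ⊕ Fin 0 := Sum.elim Empty.elim Sum.inl
    let θ : Language.ring.Formula (Fin n) := (t₁.relabel r).bdEqual (t₂.relabel r)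
    have hθ : ∀ (R : Type u) [CommRing R] (f : Fin n → R), Sat R θ f ↔
        BSat R (Language.BoundedFormula.equal t₁ t₂) f := by
      intro R _ f
      let _ := ringStructure R
      refine (Language.BoundedFormula.realize_bdEqual _ _).trans ?_
      rw [Language.Term.realize_relabel, Language.Term.realize_relabel]
      have : Sum.elim f default ∘ r = Sum.elim default f := by
        funext i; rcases i with i | i
        · exact i.elim
        · rfl
      rw [this]
      rfl
    -- Threshold 1 suffices: a stalk of R' violating the equation would have a counterpart in R.
    refine ⟨Unit, inferInstance, fun _ => θ, 1, fun R R' _ _ h h' f f' hc hs => ?_⟩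
    have hat : IsAtomic (Idem R) := h.ax1
    have hat' : IsAtomic (Idem R') := h'.ax1
    rw [← hθ, h.ax4 n θ (.equal _ _), eq_top_iff_forall_atom_le] at hs
    rw [← hθ, h'.ax4 n θ (.equal _ _), eq_top_iff_forall_atom_le]
    intro e'
    obtain ⟨e, he⟩ := hc.exists_of_pos one_ne_zero e'
    rw [atom_le_boolVal_iff]
    have h1 : () ∈ stalkType (fun _ => θ) f e := (atom_le_boolVal_iff h.ax2 e).1 (hs e)
    rw [he] at h1
    exact h1
  | rel r => exact r.elim
  | @imp n θ₁ θ₂ ih₁ ih₂ =>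
    obtain ⟨ι₁, _, ψ₁, k₁, h₁⟩ := ih₁
    obtain ⟨ι₂, _, ψ₂, k₂, h₂⟩ := ih₂
    refine ⟨ι₁ ⊕ ι₂, inferInstance, Sum.elim ψ₁ ψ₂, max k₁ k₂,
      fun R R' _ _ h h' f f' hc hs hs' => ?_⟩
    have c₁ := (hc.comp (fun T => Sum.inl ⁻¹' T)).mono (le_max_left k₁ k₂)
    have c₂ := (hc.comp (fun T => Sum.inr ⁻¹' T)).mono (le_max_right k₁ k₂)
    -- The premise is carried backwards, from R' to R, by symmetry of the counting relation.
    exact h₂ R R' h h' f f' c₂ (hs (h₁ R' R h' h f' f c₁.symm hs'))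
  | @all n θ ih =>
    classical
    obtain ⟨ι, _, ψ, k, ih⟩ := ih
    have := Fintype.ofFinite (Set ι)
    -- For each colour T the new list asks whether some element realizes T; the threshold is the one
    -- required by the witness step.
    refine ⟨Set ι, inferInstance, fun T => exLast (typeFormula ψ T), (k + 1) * Fintype.card (Set ι),
      fun R R' _ _ h h' f f' hc hs g' => ?_⟩
    obtain ⟨g, hg⟩ := exists_imitating_witness h ψ k hc.symm g'
    exact ih R R' h h' _ _ hg.symm (hs g)

/-! ### Ring homomorphisms and satisfaction -/

theorem realize_term_ringHom {R A : Type u} [CommRing R] [CommRing A] (φ : R →+* A) {α : Type}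
    (t : Language.ring.Term α) (v : α → R) :
    letI := ringStructure R
    letI := ringStructure A
    t.realize (fun a => φ (v a)) = φ (t.realize v) := by
  let _ := ringStructure R
  let _ := ringStructure A
  induction t with
  | var a => rfl
  | func F ts ih =>
    have hts : (fun i => (ts i).realize fun a => φ (v a)) = fun i => φ ((ts i).realize v) :=
      funext ih
    rw [Language.Term.realize_func, Language.Term.realize_func, hts]
    cases F with
    | add => exact (map_add φ _ _).symm
    | mul => exact (map_mul φ _ _).symm
    | neg => exact (map_neg φ _).symm
    | zero => exact (map_zero φ).symm
    | one => exact (map_one φ).symm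

theorem sat_ringEquiv {A A' : Type u} [CommRing A] [CommRing A'] (φ : A ≃+* A') {n : ℕ}
    (θ : Language.ring.Formula (Fin n)) (f : Fin n → A) :
    Sat A' θ (fun i => φ (f i)) ↔ Sat A θ f := by
  let _ := FirstOrder.Ring.compatibleRingOfRing A
  let _ := FirstOrder.Ring.compatibleRingOfRing A'
  exact Language.StrongHomClass.realize_formula
    (FirstOrder.Ring.languageEquivEquivRingEquiv.symm φ) θ (v := f)

/-- Such a surjection is itself a localization of R away from e, hence isomorphic to the stalk. -/
theorem sat_stalk_iff_of_surjective {R A : Type u} [CommRing R] [CommRing A] (e : Idem R)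
    (φ : R →+* A) (hφ : Function.Surjective φ) (h : ∀ a b, φ a = φ b ↔ (e : R) * a = e * b) {n : ℕ}
    (θ : Language.ring.Formula (Fin n)) (f : Fin n → R) :
    Sat (Stalk R e) θ (germ f e) ↔ Sat A θ fun i => φ (f i) := by
  let _ := φ.toAlgebra
  have : IsLocalization.Away (e : R) A := IsLocalization.away_of_isIdempotentElem_of_mul e.2 h hφ
  let ε : Stalk R e ≃ₐ[R] A := IsLocalization.algEquiv (Submonoid.powers (e : R)) _ _
  rw [← sat_ringEquiv ε.toRingEquiv]
  have : (fun i => ε.toRingEquiv (germ f e i)) = fun i => φ (f i) :=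
    funext fun i => ε.commutes (f i)
  rw [this]

/-- If a represents an idempotent of the stalk, then ea is an idempotent of R below the atom e, so
it is 0 or e. -/
theorem isConnectedRing_stalk {R : Type u} [CommRing R] (e : Atoms (Idem R)) :
    IsConnectedRing (Stalk R e.1) where
  zero_ne_one h := by
    rw [← map_zero (algebraMap R _), ← map_one (algebraMap R _), stalk_eq_iff] at h
    exact e.2.1 (Subtype.ext (by simpa using h.symm : (e.1 : R) = 0))
  eq_zero_or_one x hx := by
    obtain ⟨a, rfl⟩ := stalk_surjective e.1 x
    rw [IsIdempotentElem, ← map_mul, stalk_eq_iff] at hx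
    have hb : IsIdempotentElem ((e.1 : R) * a) := by
      have he : (e.1 : R) * e.1 = e.1 := e.1.2
      rw [IsIdempotentElem]
      linear_combination (a * a) * he + hx
    have hle : (⟨_, hb⟩ : Idem R) ≤ e.1 := by
      have he : (e.1 : R) * e.1 = e.1 := e.1.2
      change (e.1 : R) * a * e.1 = e.1 * a
      linear_combination a * he
    rw [← map_zero (algebraMap R _), ← map_one (algebraMap R _), stalk_eq_iff, stalk_eq_iff,
      mul_zero, mul_one]
    exact (e.2.le_iff.1 hle).imp (congr_arg Subtype.val) (congr_arg Subtype.val)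

/-! ### Products of connected rings -/

theorem snoc_apply {I : Type*} {S : I → Type*} {n : ℕ} (f : Fin n → ∀ i, S i)
    (g : ∀ i, S i) (i : I) :
    (fun j => (Fin.snoc f g : Fin (n + 1) → ∀ i, S i) j i) =
      Fin.snoc (α := fun _ => S i) (fun j => f j i) (g i) := by
  funext j
  refine Fin.lastCases ?_ (fun j => ?_) j <;> simp

section Pi

variable {I : Type u} {S : I → Type u} [∀ i, CommRing (S i)]

/-- The idempotents of a product of connected rings are the subsets of the index set. -/
noncomputable def idemPi (hS : ∀ i, IsConnectedRing (S i)) : Idem (∀ i, S i) ≃o Set I where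
  toFun b := {i | b.1 i = 1}
  invFun X := ⟨open Classical in fun i => if i ∈ X then 1 else 0, by
    funext i
    by_cases hi : i ∈ X <;> simp [hi]⟩
  left_inv b := by
    refine Subtype.ext (funext fun i => ?_)
    rcases (hS i).eq_zero_or_one (b.1 i) (congr_fun b.2 i) with h | h
    · simp [h, (hS i).zero_ne_one]
    · simp [h]
  right_inv X := by
    ext i
    by_cases hi : i ∈ X <;> simp [hi, (hS i).zero_ne_one]
  map_rel_iff' := by
    intro b b'
    constructor
    · intro h
      refine funext fun i => ?_
      rcases (hS i).eq_zero_or_one (b.1 i) (congr_fun b.2 i) with hi | hi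
      · simp [hi]
      · have : b'.1 i = 1 := h hi
        simp [hi, this]
    · intro h i hi
      have h' := congr_fun (show b.1 * b'.1 = b.1 from h) i
      simp only [Equiv.coe_fn_mk, Set.mem_ofPred_eq] at hi ⊢
      rwa [Pi.mul_apply, hi, one_mul] at h'

/-- The atom of a product of connected rings that belongs to an index. -/
noncomputable def atomPi (hS : ∀ i, IsConnectedRing (S i)) : I ≃ Atoms (Idem (∀ i, S i)) :=
  Equiv.ofBijective
    (fun i => ⟨(idemPi hS).symm {i},
      ((idemPi hS).symm.isAtom_iff _).2 (Set.isAtom_singleton i)⟩) <| by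
    constructor
    · intro i j h
      exact Set.singleton_injective ((idemPi hS).symm.injective (congr_arg Subtype.val h))
    · intro e
      obtain ⟨i, hi⟩ := Set.isAtom_iff.1 (((idemPi hS).isAtom_iff _).2 e.2)
      exact ⟨i, Subtype.ext (by simp [← hi])⟩

theorem atomPi_le_iff (hS : ∀ i, IsConnectedRing (S i)) {i : I} {b : Idem (∀ i, S i)} :
    (atomPi hS i).1 ≤ b ↔ i ∈ idemPi hS b := by
  refine ((idemPi hS).symm_apply_le).trans ?_
  exact Set.singleton_subset_iff

/-- The atom is the indicator of i, and multiplying by it retains exactly the coordinate i, so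
evaluation at i presents the stalk as S i. -/
theorem sat_stalk_atomPi (hS : ∀ i, IsConnectedRing (S i))
    (i : I) {n : ℕ} (θ : Language.ring.Formula (Fin n))
    (f : Fin n → ∀ i, S i) :
    Sat (Stalk (∀ i, S i) (atomPi hS i).1) θ (germ f (atomPi hS i).1) ↔
      Sat (S i) θ fun j => f j i := by
  classical
  have hv : ∀ j, (atomPi hS i).1.1 j = if j = i then 1 else 0 := fun j => rfl
  refine sat_stalk_iff_of_surjective _ (Pi.evalRingHom S i) (Function.surjective_eval i)
    (fun a b => ?_) θ f
  rw [funext_iff]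
  simp only [Pi.mul_apply, hv, Pi.evalRingHom_apply]
  constructor
  · intro h j
    by_cases hj : j = i
    · subst hj; simp [h]
    · simp [hj]
  · intro h; simpa using h i

theorem isBoolVal_pi_iff (hS : ∀ i, IsConnectedRing (S i))
    {n : ℕ} {θ : Language.ring.Formula (Fin n)} {f : Fin n → ∀ i, S i}
    {b : Idem (∀ i, S i)} :
    IsBoolVal _ θ f b ↔ idemPi hS b = {i | Sat (S i) θ fun j => f j i} := by
  rw [Set.ext_iff]
  constructor
  · intro h i
    rw [← atomPi_le_iff]
    exact (h _ (atomPi hS i).2).symm.trans (sat_stalk_atomPi hS i θ f)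
  · intro h e he
    obtain ⟨i, hi⟩ := (atomPi hS).surjective ⟨e, he⟩
    obtain rfl : (atomPi hS i).1 = e := congr_arg Subtype.val hi
    rw [atomPi_le_iff, sat_stalk_atomPi, h]
    rfl

theorem isAtomic_idem_pi (hS : ∀ i, IsConnectedRing (S i)) : IsAtomic (Idem (∀ i, S i)) :=
  (idemPi hS).isAtomic_iff.2 inferInstance

theorem axiom2_pi (hS : ∀ i, IsConnectedRing (S i)) : Axiom2 (∀ i, S i) := by
  intro n θ f
  refine ⟨(idemPi hS).symm {i | Sat (S i) θ fun j => f j i}, ?_, fun b hb => ?_⟩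
  · exact (isBoolVal_pi_iff hS).2 (OrderIso.apply_symm_apply _ _)
  · rw [← (isBoolVal_pi_iff hS).1 hb, OrderIso.symm_apply_apply]

theorem idemPi_boolVal (hS : ∀ i, IsConnectedRing (S i))
    (h : Axiom2 (∀ i, S i)) {n : ℕ} (θ : Language.ring.Formula (Fin n))
    (f : Fin n → ∀ i, S i) : idemPi hS (boolVal h θ f) = {i | Sat (S i) θ fun j => f j i} :=
  (isBoolVal_pi_iff hS).1 ((boolVal_eq_iff h).1 rfl)

theorem boolVal_pi_le_iff (hS : ∀ i, IsConnectedRing (S i))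
    (h : Axiom2 (∀ i, S i)) {n : ℕ} (θ : Language.ring.Formula (Fin (n + 1)))
    (f : Fin n → ∀ i, S i) (g : ∀ i, S i) (b : Idem (∀ i, S i)) :
    b ≤ boolVal h θ (Fin.snoc f g) ↔
      ∀ i ∈ idemPi hS b, Sat (S i) θ (Fin.snoc (α := fun _ => S i) (fun j => f j i) (g i)) := by
  rw [← (idemPi hS).le_iff_le, idemPi_boolVal]
  simp only [snoc_apply]
  rfl

theorem basicAxioms_pi (hS : ∀ i, IsConnectedRing (S i)) : BasicAxioms (∀ i, S i) where
  ax1 := isAtomic_idem_pi hS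
  ax2 := axiom2_pi hS
  ax3 n θ f := by
    have : ∀ i, ∃ g : S i, Sat (S i) (exLast θ) (fun j => f j i) →
        Sat (S i) θ (Fin.snoc (α := fun _ => S i) (fun j => f j i) g) := by
      intro i
      rw [sat_exLast]
      by_cases h : ∃ g : S i, Sat (S i) θ (Fin.snoc (α := fun _ => S i) (fun j => f j i) g)
      · exact h.imp fun g hg _ => hg
      · exact ⟨0, fun h' => absurd h' h⟩
    choose g hg using this
    refine ⟨g, (boolVal_pi_le_iff hS _ _ _ _ _).2 fun i hi => hg i ?_⟩
    rwa [idemPi_boolVal] at hi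
  ax4 n θ hθ f := by
    rw [← (idemPi hS).injective.eq_iff, idemPi_boolVal, map_top, Set.top_eq_univ,
      Set.eq_univ_iff_forall]
    cases hθ with
    | rel r => exact r.elim
    | equal t₁ t₂ =>
      let _ := ringStructure (∀ i, S i)
      have key : ∀ i (t : Language.ring.Term (Fin n ⊕ Fin 0)), letI := ringStructure (S i)
          t.realize (Sum.elim (fun j => f j i) default) = t.realize (Sum.elim f default) i := by
        intro i t
        have h := realize_term_ringHom (Pi.evalRingHom S i) t (Sum.elim f default)
        rw [Pi.evalRingHom_apply] at h
        rw [← h]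
        congr 1
        funext a
        rcases a with a | a
        · rfl
        · exact a.elim0
      refine funext_iff.trans (forall_congr' fun i => ?_)
      rw [← key, ← key]
      rfl

/-- For Axiom 5, the partition W behind φ* serves as Y, and conversely Y serves as W once a suitable
g is glued from coordinatewise witnesses. -/
theorem satisfiesAxioms_pi (hS : ∀ i, IsConnectedRing (S i)) : SatisfiesAxioms (∀ i, S i) where
  toBasicAxioms := basicAxioms_pi hS
  ax5 m n φ θ _ f := by
    have : IsAtomic (Idem (∀ i, S i)) := isAtomic_idem_pi hS
    constructor
    · rintro ⟨g, W, hW, hle, hφ⟩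
      refine ⟨W, hW, fun j => ?_, hφ⟩
      rw [← (idemPi hS).le_iff_le, idemPi_boolVal]
      intro i hi
      exact (sat_exLast _ _ _).2 ⟨g i, (boolVal_pi_le_iff hS _ _ _ _ _).1 (hle j) i hi⟩
    · rintro ⟨Y, hY, hle, hφ⟩
      have key : ∀ i, ∃ g : S i, ∀ j, i ∈ idemPi hS (Y j) →
          Sat (S i) (θ j) (Fin.snoc (α := fun _ => S i) (fun j => f j i) g) := by
        intro i
        -- The index lies in exactly one piece of Y, so only one formula demands a witness there.
        obtain ⟨j, hj, hj'⟩ := isPartition_iff.1 hY (atomPi hS i)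
        have h1 := hj.trans (hle j)
        rw [atomPi_le_iff, idemPi_boolVal] at h1
        obtain ⟨g, hg⟩ := (sat_exLast _ _ _).1 h1
        refine ⟨g, fun j' h' => ?_⟩
        rwa [hj' j' ((atomPi_le_iff hS).2 h')]
      choose g hg using key
      exact ⟨g, Y, hY, fun j => (boolVal_pi_le_iff hS _ _ _ _ _).2 fun i hi => hg i j hi, hφ⟩

end Pi

/-! ### Comparison of a ring with the product of its stalks -/

theorem CountEquiv.of_equiv {E E' τ : Type*} (k : ℕ) {c : E → τ} {c' : E' → τ} (ε : E ≃ E')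
    (h : ∀ e, c' (ε e) = c e) : CountEquiv k c c' := by
  intro t
  rw [← ε.injective.encard_image]
  congr 2
  ext e'
  obtain ⟨e, rfl⟩ := ε.surjective e'
  simp [h]

/-- The product is indexed by the atoms of R and its stalk at e is again R_e, so `atomPi` matches
atoms of equal colour and the counts agree for every threshold. -/
theorem elemEquiv_pi_stalk {R : Type u} [CommRing R] (h : SatisfiesAxioms R) :
    ElemEquiv R (∀ e : Atoms (Idem R), Stalk R e.1) := by
  have hS : ∀ e : Atoms (Idem R), IsConnectedRing (Stalk R e.1) := isConnectedRing_stalk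
  have h' := satisfiesAxioms_pi hS
  rw [elemEquiv_iff]
  intro θ
  obtain ⟨ι, _, ψ, k, hθ⟩ := exists_determining_types.{u} θ
  have hc : ∀ (f : Fin 0 → R) (f' : Fin 0 → ∀ e : Atoms (Idem R), Stalk R e.1),
      CountEquiv k (stalkType ψ f) (stalkType ψ f') := by
    intro f f'
    refine .of_equiv k (atomPi hS) fun e => Set.ext fun i => ?_
    refine (sat_stalk_atomPi hS e _ _).trans ?_
    rw [Subsingleton.elim (fun j => _) (germ f e.1)]
    rfl
  exact ⟨hθ _ _ h h' _ _ (hc _ _), hθ _ _ h' h _ _ (hc _ _).symm⟩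

/-! ### Definability in rings with variables for idempotents -/

section RingDefinability

instance (R : CommRingCat.{u}) : Language.ring.Structure R := ringStructure R

variable {α α' β β' γ : Type}

/-- A family of functions on rings, with arguments in the ring and arguments that are idempotents,
given by a ring term. -/
def ITerm (F : ∀ R : CommRingCat.{u}, (α → R) → (β → Idem R) → R) : Prop :=
  ∃ t : Language.ring.Term (α ⊕ β), ∀ R f y, t.realize (Sum.elim f fun b => (y b).1) = F R f y

/-- A family of relations on rings, with arguments in the ring and arguments that are idempotents,
given by a ring formula. -/
def IDef (Q : ∀ R : CommRingCat.{u}, (α → R) → (β → Idem R) → Prop) : Prop :=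
  ∃ P : ∀ R : CommRingCat.{u}, (α ⊕ β → R) → Prop, UDef Language.ring P ∧
    ∀ R f y, P R (Sum.elim f fun b => (y b).1) ↔ Q R f y

namespace ITerm

variable {F G : ∀ R : CommRingCat.{u}, (α → R) → (β → Idem R) → R}

theorem elt (a : α) : ITerm fun (R : CommRingCat.{u}) (f : α → R) (_ : β → Idem R) => f a :=
  ⟨.var (.inl a), fun _ _ _ => rfl⟩

theorem idem (b : β) : ITerm fun (R : CommRingCat.{u}) (_ : α → R) (y : β → Idem R) => (y b).1 :=
  ⟨.var (.inr b), fun _ _ _ => rfl⟩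

theorem zero : ITerm fun (R : CommRingCat.{u}) (_ : α → R) (_ : β → Idem R) => (0 : R) :=
  ⟨.func (L := Language.ring) ringFunc.zero ![], fun _ _ _ => rfl⟩

theorem one : ITerm fun (R : CommRingCat.{u}) (_ : α → R) (_ : β → Idem R) => (1 : R) :=
  ⟨.func (L := Language.ring) ringFunc.one ![], fun _ _ _ => rfl⟩

theorem add (hF : ITerm F) (hG : ITerm G) : ITerm fun R f y => F R f y + G R f y := by
  obtain ⟨t, ht⟩ := hF
  obtain ⟨s, hs⟩ := hG
  exact ⟨.func (L := Language.ring) ringFunc.add ![t, s],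
    fun R f y => congr_arg₂ _ (ht R f y) (hs R f y)⟩

theorem mul (hF : ITerm F) (hG : ITerm G) : ITerm fun R f y => F R f y * G R f y := by
  obtain ⟨t, ht⟩ := hF
  obtain ⟨s, hs⟩ := hG
  exact ⟨.func (L := Language.ring) ringFunc.mul ![t, s],
    fun R f y => congr_arg₂ _ (ht R f y) (hs R f y)⟩

theorem neg (hF : ITerm F) : ITerm fun R f y => - F R f y := by
  obtain ⟨t, ht⟩ := hF
  exact ⟨.func (L := Language.ring) ringFunc.neg ![t], fun R f y => congr_arg _ (ht R f y)⟩

theorem congr (hF : ITerm F) (h : ∀ R f y, F R f y = G R f y) : ITerm G := by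
  obtain ⟨t, ht⟩ := hF
  exact ⟨t, fun R f y => (ht R f y).trans (h R f y)⟩

theorem sub (hF : ITerm F) (hG : ITerm G) : ITerm fun R f y => F R f y - G R f y :=
  (hF.add hG.neg).congr fun _ _ _ => (sub_eq_add_neg _ _).symm

/-- Substitution of a tuple into a term of the language of rings. -/
theorem ringTerm {T : ∀ R : CommRingCat.{u}, (α → R) → (β → Idem R) → γ → R}
    (hT : ∀ c, ITerm fun R f y => T R f y c) (t : Language.ring.Term γ) :
    ITerm fun R f y => t.realize (T R f y) := by
  induction t with
  | var c => exact hT c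
  | func F ts ih =>
    cases F with
    | add => exact (ih 0).add (ih 1)
    | mul => exact (ih 0).mul (ih 1)
    | neg => exact (ih 0).neg
    | zero => exact zero
    | one => exact one

end ITerm

namespace IDef

variable {Q Q' : ∀ R : CommRingCat.{u}, (α → R) → (β → Idem R) → Prop}

theorem congr (h : IDef Q) (hQ : ∀ R f y, Q R f y ↔ Q' R f y) : IDef Q' := by
  obtain ⟨P, hP, hPQ⟩ := h
  exact ⟨P, hP, fun R f y => (hPQ R f y).trans (hQ R f y)⟩

protected theorem not (h : IDef Q) : IDef fun R f y => ¬ Q R f y := by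
  obtain ⟨P, hP, hPQ⟩ := h
  exact ⟨_, hP.not, fun R f y => not_congr (hPQ R f y)⟩

theorem imp (h : IDef Q) (h' : IDef Q') : IDef fun R f y => Q R f y → Q' R f y := by
  obtain ⟨P, hP, hPQ⟩ := h
  obtain ⟨P', hP', hPQ'⟩ := h'
  exact ⟨_, hP.imp hP', fun R f y => imp_congr (hPQ R f y) (hPQ' R f y)⟩

protected theorem and (h : IDef Q) (h' : IDef Q') : IDef fun R f y => Q R f y ∧ Q' R f y := by
  obtain ⟨P, hP, hPQ⟩ := h
  obtain ⟨P', hP', hPQ'⟩ := h'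
  exact ⟨_, hP.and hP', fun R f y => and_congr (hPQ R f y) (hPQ' R f y)⟩

protected theorem or (h : IDef Q) (h' : IDef Q') : IDef fun R f y => Q R f y ∨ Q' R f y := by
  obtain ⟨P, hP, hPQ⟩ := h
  obtain ⟨P', hP', hPQ'⟩ := h'
  exact ⟨_, hP.or hP', fun R f y => or_congr (hPQ R f y) (hPQ' R f y)⟩

theorem iff (h : IDef Q) (h' : IDef Q') : IDef fun R f y => (Q R f y ↔ Q' R f y) := by
  obtain ⟨P, hP, hPQ⟩ := h
  obtain ⟨P', hP', hPQ'⟩ := h'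
  exact ⟨_, hP.iff hP', fun R f y => iff_congr (hPQ R f y) (hPQ' R f y)⟩

theorem const (p : Prop) : IDef fun (R : CommRingCat.{u}) (_ : α → R) (_ : β → Idem R) => p :=
  ⟨_, UDef.const p, fun _ _ _ => Iff.rfl⟩

theorem finAll {ι : Type} [Finite ι]
    {Q : ι → ∀ R : CommRingCat.{u}, (α → R) → (β → Idem R) → Prop} (h : ∀ i, IDef (Q i)) :
    IDef fun R f y => ∀ i, Q i R f y := by
  choose P hP hPQ using h
  exact ⟨_, UDef.finAll hP, fun R f y => forall_congr' fun i => hPQ i R f y⟩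

theorem eq {F G : ∀ R : CommRingCat.{u}, (α → R) → (β → Idem R) → R} (hF : ITerm F)
    (hG : ITerm G) : IDef fun R f y => F R f y = G R f y := by
  obtain ⟨t, ht⟩ := hF
  obtain ⟨s, hs⟩ := hG
  exact ⟨_, UDef.eq ⟨t, fun _ _ => rfl⟩ ⟨s, fun _ _ => rfl⟩, fun R f y => by rw [ht, hs]⟩

theorem relabel (h : IDef Q) (ρ : α → α') (τ : β → β') :
    IDef fun R (f : α' → R) (y : β' → Idem R) => Q R (fun a => f (ρ a)) fun b => y (τ b) := by
  obtain ⟨P, hP, hPQ⟩ := h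
  refine ⟨_, hP.relabel (Sum.map ρ τ), fun R f y => ?_⟩
  refine Iff.trans (iff_of_eq (congr_arg _ (funext fun a => ?_))) (hPQ R _ _)
  rcases a with a | a <;> rfl

theorem all_elts [Finite γ] {Q : ∀ R : CommRingCat.{u}, (α → R) → (β → Idem R) → (γ → R) → Prop}
    (h : IDef fun R (f : α ⊕ γ → R) y => Q R (fun a => f (.inl a)) y fun c => f (.inr c)) :
    IDef fun R f y => ∀ g, Q R f y g := by
  obtain ⟨P, hP, hPQ⟩ := h
  let ρ : (α ⊕ γ) ⊕ β → (α ⊕ β) ⊕ γ :=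
    Sum.elim (Sum.elim (fun a => .inl (.inl a)) fun c => .inr c) fun b => .inl (.inr b)
  refine ⟨fun R v => ∀ g : γ → R, P R fun a => Sum.elim v g (ρ a), UDef.all ?_, fun R f y => ?_⟩
  · refine (hP.relabel ρ).congr fun R v => iff_of_eq (congr_arg _ (funext fun a => ?_))
    rcases a with (a | a) | a <;> rfl
  · refine forall_congr' fun g => Iff.trans (iff_of_eq (congr_arg _ (funext fun a => ?_)))
      (hPQ R (Sum.elim f g) y)
    rcases a with (a | a) | a <;> rfl

/-- Quantifiers over idempotents are relativized to ring elements satisfying xx = x. -/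
theorem all_idems [Finite γ]
    {Q : ∀ R : CommRingCat.{u}, (α → R) → (β → Idem R) → (γ → Idem R) → Prop}
    (h : IDef fun R f (y : β ⊕ γ → Idem R) => Q R f (fun b => y (.inl b)) fun c => y (.inr c)) :
    IDef fun R f y => ∀ z, Q R f y z := by
  obtain ⟨P, hP, hPQ⟩ := h
  let ρ : α ⊕ (β ⊕ γ) → (α ⊕ β) ⊕ γ :=
    Sum.elim (fun a => .inl (.inl a)) (Sum.elim (fun b => .inl (.inr b)) fun c => .inr c)
  refine ⟨fun R v => ∀ g : γ → R, (∀ c, IsIdempotentElem (g c)) → P R fun a => Sum.elim v g (ρ a),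
    UDef.all (UDef.imp (UDef.finAll fun c => ?_) ?_), fun R f y => ?_⟩
  · exact UDef.eq ⟨.func (L := Language.ring) ringFunc.mul ![.var (Sum.inr c), .var (Sum.inr c)],
      fun _ _ => rfl⟩ (.var _)
  · refine (hP.relabel ρ).congr fun R v => iff_of_eq (congr_arg _ (funext fun a => ?_))
    rcases a with a | a | a <;> rfl
  · have key : ∀ z : γ → Idem R,
        (P R fun a => Sum.elim (Sum.elim f fun b => (y b).1) (fun c => (z c).1) (ρ a)) ↔
          Q R f y z := by
      intro z
      refine Iff.trans (iff_of_eq (congr_arg _ (funext fun a => ?_))) (hPQ R f (Sum.elim y z))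
      rcases a with a | a | a <;> rfl
    exact ⟨fun H z => (key z).1 (H _ fun c => (z c).2),
      fun H g hg => (key fun c => ⟨g c, hg c⟩).2 (H _)⟩

theorem ex_idems [Finite γ]
    {Q : ∀ R : CommRingCat.{u}, (α → R) → (β → Idem R) → (γ → Idem R) → Prop}
    (h : IDef fun R f (y : β ⊕ γ → Idem R) => Q R f (fun b => y (.inl b)) fun c => y (.inr c)) :
    IDef fun R f y => ∃ z, Q R f y z :=
  (all_idems (Q := fun R f y z => ¬ Q R f y z) h.not).not.congr fun R f y => by simp

theorem all_elt {Q : ∀ R : CommRingCat.{u}, (α → R) → (β → Idem R) → R → Prop}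
    (h : IDef fun R (f : α ⊕ Unit → R) y => Q R (fun a => f (.inl a)) y (f (.inr ()))) :
    IDef fun R f y => ∀ g, Q R f y g :=
  (all_elts (Q := fun R f y (g : Unit → R) => Q R f y (g ())) h).congr fun _ _ _ =>
    ⟨fun H a => H fun _ => a, fun H g => H (g ())⟩

theorem ex_elt {Q : ∀ R : CommRingCat.{u}, (α → R) → (β → Idem R) → R → Prop}
    (h : IDef fun R (f : α ⊕ Unit → R) y => Q R (fun a => f (.inl a)) y (f (.inr ()))) :
    IDef fun R f y => ∃ g, Q R f y g :=
  (all_elt (Q := fun R f y g => ¬ Q R f y g) h.not).not.congr fun R f y => by simp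

theorem all_idem {Q : ∀ R : CommRingCat.{u}, (α → R) → (β → Idem R) → Idem R → Prop}
    (h : IDef fun R f (y : β ⊕ Unit → Idem R) => Q R f (fun b => y (.inl b)) (y (.inr ()))) :
    IDef fun R f y => ∀ z, Q R f y z :=
  (all_idems (Q := fun R f y (z : Unit → Idem R) => Q R f y (z ())) h).congr fun _ _ _ =>
    ⟨fun H a => H fun _ => a, fun H g => H (g ())⟩

theorem ex_idem {Q : ∀ R : CommRingCat.{u}, (α → R) → (β → Idem R) → Idem R → Prop}
    (h : IDef fun R f (y : β ⊕ Unit → Idem R) => Q R f (fun b => y (.inl b)) (y (.inr ()))) :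
    IDef fun R f y => ∃ z, Q R f y z :=
  (all_idem (Q := fun R f y z => ¬ Q R f y z) h.not).not.congr fun R f y => by simp

theorem eq_idem {F G : ∀ R : CommRingCat.{u}, (α → R) → (β → Idem R) → Idem R}
    (hF : ITerm fun R f y => (F R f y).1) (hG : ITerm fun R f y => (G R f y).1) :
    IDef fun R f y => F R f y = G R f y :=
  (IDef.eq hF hG).congr fun _ _ _ => Subtype.ext_iff.symm

theorem le (b b' : β) :
    IDef fun (R : CommRingCat.{u}) (_ : α → R) (y : β → Idem R) => y b ≤ y b' :=
  IDef.eq ((ITerm.idem b).mul (.idem b')) (.idem b)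

theorem isAtom (b : β) :
    IDef fun (R : CommRingCat.{u}) (_ : α → R) (y : β → Idem R) => IsAtom (y b) := by
  have h : IDef fun (R : CommRingCat.{u}) (_ : α → R) (y : β → Idem R) =>
      ¬ y b = ⊥ ∧ ∀ x, x ≤ y b → x = ⊥ ∨ x = y b :=
    (IDef.eq_idem (.idem b) .zero).not.and <| IDef.all_idem <|
      (IDef.le _ _).imp <| (IDef.eq_idem (.idem _) .zero).or (IDef.eq_idem (.idem _) (.idem _))
  refine h.congr fun R f y => ?_
  constructor
  · rintro ⟨h1, h2⟩
    exact ⟨h1, fun x hx => (h2 x hx.le).resolve_right hx.ne⟩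
  · exact fun h => ⟨h.1, fun x hx => h.le_iff.1 hx⟩

theorem isAtomic : IDef fun (R : CommRingCat.{u}) (_ : α → R) (_ : β → Idem R) =>
    IsAtomic (Idem R) := by
  have h : IDef fun (R : CommRingCat.{u}) (_ : α → R) (_ : β → Idem R) =>
      ∀ b : Idem R, b = ⊥ ∨ ∃ a, IsAtom a ∧ a ≤ b :=
    IDef.all_idem <| (IDef.eq_idem (.idem _) .zero).or <| IDef.ex_idem <|
      (IDef.isAtom _).and (IDef.le _ _)
  exact h.congr fun R _ _ => (isAtomic_iff _).symm

/-- The join being 1 is expressed by saying that 1 is the only common upper bound, which avoids a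
term for the finite join. -/
theorem isPartition {m : ℕ} (τ : Fin m → β) :
    IDef fun (R : CommRingCat.{u}) (_ : α → R) (y : β → Idem R) =>
      IsPartition fun j => y (τ j) := by
  have h : IDef fun (R : CommRingCat.{u}) (_ : α → R) (y : β → Idem R) =>
      (∀ b : Idem R, (∀ j, y (τ j) ≤ b) → b = ⊤) ∧ ∀ i j, i ≠ j → y (τ i) ⊓ y (τ j) = ⊥ :=
    (IDef.all_idem <| (IDef.finAll fun j => IDef.le _ _).imp (IDef.eq_idem (.idem _) .one)).and <|
      IDef.finAll fun i => IDef.finAll fun j => (IDef.const _).imp <|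
        IDef.eq_idem ((ITerm.idem (τ i)).mul (.idem (τ j))) .zero
  refine h.congr fun R f y => and_congr_left' ⟨fun H => ?_, fun H b hb => ?_⟩
  · exact H _ fun j => Finset.le_sup (f := fun j => y (τ j)) (Finset.mem_univ j)
  · exact top_le_iff.1 (H ▸ Finset.sup_le fun j _ => hb j)

theorem sat {n : ℕ} (θ : Language.ring.Formula (Fin n)) :
    IDef fun (R : CommRingCat.{u}) (f : Fin n → R) (_ : β → Idem R) => Sat R θ f :=
  ⟨fun R v => Sat R θ fun a => v (.inl a), UDef.relabel ⟨θ, fun _ _ => Iff.rfl⟩ Sum.inl,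
    fun _ _ _ => Iff.rfl⟩

end IDef

end RingDefinability

/-! ### The axioms are first-order -/

section Axioms

variable {α β : Type}

/-- The stalk at e is interpreted in R: its elements are represented by ring elements, since the
localization map is surjective, and equality of a and b becomes ea = eb. -/
theorem IDef.stalk_realize {n l : ℕ} (θ : Language.ring.BoundedFormula (Fin n) l) :
    IDef fun (R : CommRingCat.{u}) (v : Fin n ⊕ Fin l → R) (y : Unit → Idem R) =>
      letI := ringStructure (Stalk R (y ()))
      θ.Realize (fun i => algebraMap R (Stalk R (y ())) (v (.inl i)))
        fun j => algebraMap R (Stalk R (y ())) (v (.inr j)) := by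
  induction θ with
  | falsum => exact IDef.const False
  | @equal l t₁ t₂ =>
    have h : IDef fun (R : CommRingCat.{u}) (v : Fin n ⊕ Fin l → R) (y : Unit → Idem R) =>
        (y ()).1 * t₁.realize v = (y ()).1 * t₂.realize v :=
      IDef.eq ((ITerm.idem ()).mul (.ringTerm (T := fun R v y => v) (fun c => .elt c) t₁))
        ((ITerm.idem ()).mul (.ringTerm (T := fun R v y => v) (fun c => .elt c) t₂))
    refine h.congr fun R v y => ?_
    let _ := ringStructure (Stalk R (y ()))
    have key : ∀ t : Language.ring.Term (Fin n ⊕ Fin l),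
        t.realize (Sum.elim (fun i => algebraMap R (Stalk R (y ())) (v (.inl i)))
          fun j => algebraMap R (Stalk R (y ())) (v (.inr j))) =
        algebraMap R (Stalk R (y ())) (t.realize v) := by
      intro t
      refine Eq.trans ?_ (realize_term_ringHom (algebraMap R (Stalk R (y ()))) t v)
      congr 1
      funext a
      rcases a with a | a <;> rfl
    refine (stalk_eq_iff (y ())).symm.trans ?_
    rw [← key, ← key]
    rfl
  | rel r => exact r.elim
  | imp _ _ ih₁ ih₂ => exact ih₁.imp ih₂
  | @all l θ ih =>
    let ρ : Fin n ⊕ Fin (l + 1) → (Fin n ⊕ Fin l) ⊕ Unit :=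
      Sum.elim (fun i => .inl (.inl i)) (Fin.lastCases (.inr ()) fun j => .inl (.inr j))
    have h : IDef fun (R : CommRingCat.{u}) (v : Fin n ⊕ Fin l → R) (y : Unit → Idem R) =>
        ∀ a : R, letI := ringStructure (Stalk R (y ()))
          θ.Realize (fun i => algebraMap R (Stalk R (y ())) (v (.inl i)))
            (Fin.snoc (α := fun _ => Stalk R (y ()))
              (fun j => algebraMap R (Stalk R (y ())) (v (.inr j))) (algebraMap R _ a)) := by
      refine IDef.all_elt ((ih.relabel ρ id).congr fun R v y => ?_)
      refine iff_of_eq (congr_arg _ (funext fun j => ?_))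
      refine Fin.lastCases ?_ (fun j => ?_) j <;> simp [ρ]
    refine h.congr fun R v y => ?_
    exact ((stalk_surjective (y ())).forall (p := fun x =>
      letI := ringStructure (Stalk R (y ()))
      θ.Realize (fun i => algebraMap R (Stalk R (y ())) (v (.inl i)))
        (Fin.snoc (α := fun _ => Stalk R (y ()))
          (fun j => algebraMap R (Stalk R (y ())) (v (.inr j))) x))).symm

theorem IDef.sat_stalk {n : ℕ} (θ : Language.ring.Formula (Fin n)) (ρ : Fin n → α) (b : β) :
    IDef fun (R : CommRingCat.{u}) (v : α → R) (y : β → Idem R) =>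
      Sat (Stalk R (y b)) θ (germ (fun i => v (ρ i)) (y b)) := by
  have h : IDef fun (R : CommRingCat.{u}) (v : Fin n → R) (y : Unit → Idem R) =>
      Sat (Stalk R (y ())) θ (germ v (y ())) := by
    obtain ⟨P, hP, hPQ⟩ := IDef.stalk_realize.{u} θ
    refine ⟨fun R v => P R fun a => v (Sum.map (Sum.elim id Fin.elim0) id a),
      hP.relabel _, fun R v y => ?_⟩
    refine Iff.trans (iff_of_eq (congr_arg _ (funext fun a => ?_)))
      ((hPQ R (Sum.elim v Fin.elim0) y).trans (iff_of_eq (congr_arg _ (Subsingleton.elim _ _))))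
    rcases a with (a | a) | a
    · rfl
    · exact a.elim0
    · rfl
  exact h.relabel ρ fun _ => b

theorem IDef.isBoolVal {n : ℕ} (θ : Language.ring.Formula (Fin n)) (ρ : Fin n → α) (b : β) :
    IDef fun (R : CommRingCat.{u}) (v : α → R) (y : β → Idem R) =>
      IsBoolVal R θ (fun i => v (ρ i)) (y b) :=
  IDef.all_idem <| (IDef.isAtom _).imp <| (IDef.sat_stalk θ ρ _).iff (IDef.le _ _)

theorem ITerm.boolTerm (t : boolLang.Term β) :
    ITerm fun (R : CommRingCat.{u}) (_ : α → R) (y : β → Idem R) =>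
      letI := boolStructure (Idem R)
      (t.realize y : Idem R).1 := by
  induction t with
  | var b => exact ITerm.idem b
  | func F ts ih =>
    cases F with
    | inf => exact (ih 0).mul (ih 1)
    | sup => exact ((ih 0).add (ih 1)).sub ((ih 0).mul (ih 1))
    | compl => exact ITerm.one.sub (ih 0)
    | bot => exact ITerm.zero
    | top => exact ITerm.one

/-- The Boolean operations on idempotents are ring polynomials, so 𝔹 is interpreted in R. -/
theorem IDef.idem_realize {m l : ℕ} (φ : boolLang.BoundedFormula (Fin m) l) :
    IDef fun (R : CommRingCat.{u}) (_ : α → R) (y : Fin m ⊕ Fin l → Idem R) =>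
      letI := boolStructure (Idem R)
      φ.Realize (fun i => y (.inl i)) fun j => y (.inr j) := by
  induction φ with
  | falsum => exact IDef.const False
  | @equal l t₁ t₂ =>
    refine (IDef.eq_idem (ITerm.boolTerm t₁) (ITerm.boolTerm t₂)).congr fun R f y => ?_
    let _ := boolStructure (Idem R)
    have h : Sum.elim (fun i => y (.inl i)) (fun j => y (.inr j)) = y := by
      funext a
      rcases a with a | a <;> rfl
    have h' : ∀ t : boolLang.Term (Fin m ⊕ Fin l),
        t.realize (Sum.elim (fun i => y (.inl i)) (fun j => y (.inr j))) = t.realize y :=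
      fun t => by rw [h]
    exact iff_of_eq (congr_arg₂ _ (h' t₁).symm (h' t₂).symm)
  | rel r => exact r.elim
  | imp _ _ ih₁ ih₂ => exact ih₁.imp ih₂
  | @all l φ ih =>
    let ρ : Fin m ⊕ Fin (l + 1) → (Fin m ⊕ Fin l) ⊕ Unit :=
      Sum.elim (fun i => .inl (.inl i)) (Fin.lastCases (.inr ()) fun j => .inl (.inr j))
    refine IDef.all_idem ((ih.relabel id ρ).congr fun R v y => ?_)
    refine iff_of_eq (congr_arg _ (funext fun j => ?_))
    refine Fin.lastCases ?_ (fun j => ?_) j <;> simp [ρ]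

theorem IDef.boolSat {m : ℕ} (φ : boolLang.Formula (Fin m)) (τ : Fin m → β) :
    IDef fun (R : CommRingCat.{u}) (_ : α → R) (y : β → Idem R) =>
      BoolSat (Idem R) φ fun j => y (τ j) := by
  have h : IDef fun (R : CommRingCat.{u}) (_ : α → R) (y : Fin m → Idem R) =>
      BoolSat (Idem R) φ y := by
    obtain ⟨P, hP, hPQ⟩ := IDef.idem_realize.{u} (α := α) φ
    refine ⟨fun R v => P R fun a => v (Sum.map id (Sum.elim id Fin.elim0) a),
      hP.relabel _, fun R v y => ?_⟩
    refine Iff.trans (iff_of_eq (congr_arg _ (funext fun a => ?_)))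
      ((hPQ R v (Sum.elim y Fin.elim0)).trans (iff_of_eq (congr_arg _ (Subsingleton.elim _ _))))
    rcases a with a | a | a
    · rfl
    · rfl
    · exact a.elim0
  exact h.relabel id τ

theorem IDef.starSat {m : ℕ} (φ : boolLang.Formula (Fin m)) (τ : Fin m → β) :
    IDef fun (R : CommRingCat.{u}) (_ : α → R) (y : β → Idem R) =>
      StarSat (Idem R) φ fun j => y (τ j) :=
  IDef.ex_idems <| (IDef.isPartition _).and <| (IDef.finAll fun _ => IDef.le _ _).and <|
    IDef.boolSat φ _

theorem IDef.isBoolVal_snoc {n : ℕ} (θ : Language.ring.Formula (Fin (n + 1))) (ρ : Fin n → α)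
    (a : α) (b : β) :
    IDef fun (R : CommRingCat.{u}) (v : α → R) (y : β → Idem R) =>
      IsBoolVal R θ (Fin.snoc (α := fun _ => R) (fun i => v (ρ i)) (v a)) (y b) := by
  refine (IDef.isBoolVal θ (Fin.snoc (α := fun _ => α) ρ a) b).congr fun R v y => ?_
  refine iff_of_eq (congr_arg (IsBoolVal R θ · (y b)) (funext fun j => ?_))
  refine Fin.lastCases ?_ (fun j => ?_) j <;> simp

/-- A definable property without free variables is invariant under elementary equivalence. -/
theorem ElemEquiv.iff_of_iDef {R S : Type u} [CommRing R] [CommRing S] (h : ElemEquiv R S)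
    {Q : CommRingCat.{u} → Prop}
    (hQ : IDef fun R (_ : Empty → R) (_ : Empty → Idem R) => Q R) : Q (.of R) ↔ Q (.of S) := by
  obtain ⟨P, hP, hPQ⟩ := hQ
  -- Merging the two empty sorts of variables turns the defining formula into a sentence.
  obtain ⟨φ, hφ⟩ := hP.relabel (Sum.elim id id : Empty ⊕ Empty → Empty)
  have key : ∀ T : CommRingCat.{u}, BSat T φ default ↔ Q T := by
    intro T
    refine Iff.trans ?_ (hPQ T Empty.elim Empty.elim)
    refine Iff.trans ?_ ((hφ T default).trans (iff_of_eq (congr_arg _ (Subsingleton.elim _ _))))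
    exact iff_of_eq (congr_arg _ (Subsingleton.elim _ _))
  rw [← key, ← key]
  exact elemEquiv_iff.1 h φ

/-- Each instance of the axioms becomes a definable property once the chosen value `boolVal` is
replaced by a quantified idempotent satisfying `IsBoolVal`. Being a partition sequence does not
refer to R or S, so both rings face the same instances of Axiom 5. -/
theorem ElemEquiv.satisfiesAxioms {R S : Type u} [CommRing R] [CommRing S] (h : ElemEquiv R S)
    (hS : SatisfiesAxioms S) : SatisfiesAxioms R := by
  have h1 : Axiom1 R := (h.iff_of_iDef (Q := fun T => IsAtomic (Idem T)) IDef.isAtomic).2 hS.ax1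
  have h2 : Axiom2 R := by
    intro n θ
    refine (h.iff_of_iDef (Q := fun T => ∀ f : Fin n → T, ∃ b : Idem T, IsBoolVal T θ f b ∧
      ∀ b', IsBoolVal T θ f b' → b' = b) ?_).2 (hS.ax2 n θ)
    exact IDef.all_elts <| IDef.ex_idem <| (IDef.isBoolVal θ _ _).and <| IDef.all_idem <|
      (IDef.isBoolVal θ _ _).imp (IDef.eq_idem (.idem _) (.idem _))
  refine ⟨⟨h1, h2, fun n θ => ?_, fun n θ hθ => ?_⟩, fun m n φ θ hθ => ?_⟩
  · have key : ∀ (T : Type u) [CommRing T] (hT : Axiom2 T) (f : Fin n → T),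
        (∃ g : T, boolVal hT (exLast θ) f ≤ boolVal hT θ (Fin.snoc f g)) ↔
          ∃ g : T, ∃ b b' : Idem T, IsBoolVal T (exLast θ) f b ∧
            IsBoolVal T θ (Fin.snoc f g) b' ∧ b ≤ b' := by
      intro T _ hT f
      refine exists_congr fun g => ?_
      simp only [← boolVal_eq_iff hT]
      exact ⟨fun H => ⟨_, _, rfl, rfl, H⟩, by rintro ⟨_, _, rfl, rfl, H⟩; exact H⟩
    simp only [key]
    refine (h.iff_of_iDef (Q := fun T => ∀ f : Fin n → T, ∃ g : T, ∃ b b' : Idem T,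
      IsBoolVal T (exLast θ) f b ∧ IsBoolVal T θ (Fin.snoc f g) b' ∧ b ≤ b') ?_).2
      fun f => (key S hS.ax2 f).1 (hS.ax3 n θ f)
    exact IDef.all_elts <| IDef.ex_elt <| IDef.ex_idem <| IDef.ex_idem <|
      (IDef.isBoolVal _ _ _).and <| (IDef.isBoolVal_snoc θ _ _ _).and <| IDef.le _ _
  · simp only [boolVal_eq_iff h2]
    -- Definability of `IsBoolVal` is available at an idempotent variable, so the constant 1 enters
    -- through a variable equal to it.
    have key : ∀ (T : Type u) [CommRing T] (f : Fin n → T),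
        IsBoolVal T θ f ⊤ ↔ ∃ b : Idem T, b = ⊤ ∧ IsBoolVal T θ f b := by simp
    simp only [key]
    refine (h.iff_of_iDef (Q := fun T => ∀ f : Fin n → T, Sat T θ f ↔
      ∃ b : Idem T, b = ⊤ ∧ IsBoolVal T θ f b) ?_).2
        fun f => (hS.ax4 n θ hθ f).trans ((boolVal_eq_iff hS.ax2).trans (key S f))
    exact IDef.all_elts <| ((IDef.sat θ).relabel _ id).iff <| IDef.ex_idem <|
      (IDef.eq_idem (.idem _) .one).and <| IDef.isBoolVal _ _ _
  · have key : ∀ (T : Type u) [CommRing T] (hT : Axiom2 T) (f : Fin n → T),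
        ((∃ g : T, StarSat (Idem T) φ fun j => boolVal hT (θ j) (Fin.snoc f g)) ↔
          ∃ Y : Fin (m + 1) → Idem T, IsPartition Y ∧
            (∀ j, Y j ≤ boolVal hT (exLast (θ j)) f) ∧ BoolSat (Idem T) φ Y) ↔
        ((∃ g : T, ∃ v : Fin (m + 1) → Idem T, (∀ j, IsBoolVal T (θ j) (Fin.snoc f g) (v j)) ∧
            StarSat (Idem T) φ v) ↔
          ∃ Y v : Fin (m + 1) → Idem T, (∀ j, IsBoolVal T (exLast (θ j)) f (v j)) ∧
            IsPartition Y ∧ (∀ j, Y j ≤ v j) ∧ BoolSat (Idem T) φ Y) := by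
      intro T _ hT f
      simp only [← boolVal_eq_iff hT, ← funext_iff, exists_eq_left']
    simp only [key]
    refine (h.iff_of_iDef (Q := fun T => ∀ f : Fin n → T,
      (∃ g : T, ∃ v : Fin (m + 1) → Idem T, (∀ j, IsBoolVal T (θ j) (Fin.snoc f g) (v j)) ∧
          StarSat (Idem T) φ v) ↔
        ∃ Y v : Fin (m + 1) → Idem T, (∀ j, IsBoolVal T (exLast (θ j)) f (v j)) ∧
          IsPartition Y ∧ (∀ j, Y j ≤ v j) ∧ BoolSat (Idem T) φ Y) ?_).2
      fun f => (key S hS.ax2 f).1 (hS.ax5 m n φ θ hθ f)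
    refine IDef.all_elts (IDef.iff ?_ ?_)
    · exact IDef.ex_elt <| IDef.ex_idems <|
        (IDef.finAll fun j => IDef.isBoolVal_snoc (θ j) _ _ _).and <| IDef.starSat φ _
    · exact IDef.ex_idems <| IDef.ex_idems <|
        (IDef.finAll fun j => IDef.isBoolVal (exLast (θ j)) _ _).and <|
          (IDef.isPartition _).and <| (IDef.finAll fun j => IDef.le _ _).and <| IDef.boolSat φ _

end Axioms

end FVRing

theorem mainTheorem2 :
    (∀ (R : Type u) [CommRing R], FVRing.SatisfiesAxioms R →
      FVRing.ElemEquiv R (∀ e : {e : FVRing.Idem R // IsAtom e}, FVRing.Stalk R e.1)) ∧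
    (∀ (I : Type u) (S : I → Type u) [∀ i, CommRing (S i)],
      (∀ i, FVRing.IsConnectedRing (S i)) → FVRing.SatisfiesAxioms (∀ i, S i)) ∧
    (∀ (R : Type u) [CommRing R], FVRing.SatisfiesAxioms R ↔
      ∃ (I : Type u) (S : I → Type u) (_ : ∀ i, CommRing (S i)),
        (∀ i, FVRing.IsConnectedRing (S i)) ∧ FVRing.ElemEquiv R (∀ i, S i)) :=
  ⟨fun _ _ h => FVRing.elemEquiv_pi_stalk h, fun _ _ _ hS => FVRing.satisfiesAxioms_pi hS,
    fun R _ => ⟨fun h => ⟨{e : FVRing.Idem R // IsAtom e}, fun e => FVRing.Stalk R e.1,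
      fun _ => inferInstance, FVRing.isConnectedRing_stalk, FVRing.elemEquiv_pi_stalk h⟩,
      fun ⟨_, _, _, hS, h⟩ => h.satisfiesAxioms (FVRing.satisfiesAxioms_pi hS)⟩⟩
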